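/- Let $M'$ be a lattice of rank $n'$, let $r \ge 0$ be an integer, and let $\Delta_0,\dots,\Delta_r \subset M'_{\mathbb R} := M'\otimes_{\mathbb Z}\mathbb R$ be (nonempty) lattice polytopes, i.e. convex hulls of nonempty finite subsets of $M'$. For a lattice $M$ and a lattice polytope $\Delta \subset M_{\mathbb R}$, of any dimension $\dim \Delta \le \operatorname{rank} M$, the degree $\deg(\Delta)$ is the degree of the polynomial $$(1-t)^{\dim(\Delta)+1}\sum_{k\ge 0} |k\Delta\cap M|\,t^k .$$ Let $e_0,\dots,e_r$ be the vertices of the standard simplex in $\mathbb R^r$ ($e_0=0$ and $e_1,\dots,e_r$ the standard basis). The Cayley polytope $\Delta_0*\cdots*\Delta_r$ is the convex hull of $\bigcup_{i=0}^r \Delta_i\times\{e_i\}$ in $M'_{\mathbb R}\oplus\mathbb R^r$, a lattice polytope with respect to the lattice $M'\oplus\mathbb Z^r$. Then $$\deg(\Delta_0*\cdots*\Delta_r)\ \le\ \dim(\Delta_0+\cdots+\Delta_r)\ \le\ n',$$ where $\Delta_0+\cdots+\Delta_r$ is the Minkowski sum. Moreover, if $\Delta_0*\cdots*\Delta_r$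 is an $r$-fold pyramid over $\Delta_0$, that is, if $\dim(\Delta_1)=\cdots=\dim(\Delta_r)=0$, then $$\deg(\Delta_0*\cdots*\Delta_r)=\deg(\Delta_0).$$ -/

import Mathlib

open scoped Pointwise Polynomial PowerSeries

/-- `Δ` is a lattice polytope with respect to the lattice `L`: the convex hull of a nonempty
finite set of points of `L`. -/
def IsLatticePolytope {E : Type*} [AddCommGroup E] [Module ℝ E]
    (L : Submodule ℤ E) (Δ : Set E) : Prop :=
  ∃ V : Finset E, V.Nonempty ∧ (V : Set E) ⊆ (L : Set E) ∧ Δ = convexHull ℝ (V : Set E)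

/-- The dimension of a (nonempty) convex set: the dimension of its affine span. -/
noncomputable def polytopeDim {E : Type*} [AddCommGroup E] [Module ℝ E] (Δ : Set E) : ℕ :=
  Module.finrank ℝ (vectorSpan ℝ Δ)

/-- The Ehrhart series `P(Δ, t) = ∑_{k ≥ 0} |kΔ ∩ L| t ^ k`. -/
noncomputable def ehrhartSeries {E : Type*} [AddCommGroup E] [Module ℝ E]
    (L : Submodule ℤ E) (Δ : Set E) : ℤ⟦X⟧ :=
  PowerSeries.mk fun k : ℕ => ((((k : ℝ) • Δ) ∩ (L : Set E)).ncard : ℤ)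

/-- The `h^*`-series `(1 - t) ^ (dim Δ + 1) P(Δ, t)`. -/
noncomputable def hStarSeries {E : Type*} [AddCommGroup E] [Module ℝ E]
    (L : Submodule ℤ E) (Δ : Set E) : ℤ⟦X⟧ :=
  (1 - PowerSeries.X) ^ (polytopeDim Δ + 1) * ehrhartSeries L Δ

/-- The degree `deg Δ` of a lattice polytope: the degree of the polynomial
`(1 - t) ^ (dim Δ + 1) P(Δ, t)`. There is at most one polynomial `h` to take the infimum over;
if the series were not a polynomial, the value would be `⊤`, so that any finite bound on the
degree includes the assertion that the series is a polynomial. -/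
noncomputable def latticeDegree {E : Type*} [AddCommGroup E] [Module ℝ E]
    (L : Submodule ℤ E) (Δ : Set E) : ℕ∞ :=
  ⨅ (h : ℤ[X]) (_ : (h : ℤ⟦X⟧) = hStarSeries L Δ), (h.natDegree : ℕ∞)

theorem latticeDegree_eq_natDegree {E : Type*} [AddCommGroup E] [Module ℝ E]
    (L : Submodule ℤ E) (Δ : Set E) (h : ℤ[X]) (hh : (h : ℤ⟦X⟧) = hStarSeries L Δ) :
    latticeDegree L Δ = (h.natDegree : ℕ∞) := by
  refine le_antisymm (iInf₂_le h hh) (le_iInf₂ fun g hg => ?_)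
  rw [Polynomial.coe_injective ℤ (hg.trans hh.symm)]

/-- The lattice `ℤ ^ r` in `ℝ ^ r`. -/
noncomputable def intLattice (r : ℕ) : Submodule ℤ (Fin r → ℝ) :=
  Submodule.span ℤ (Set.range (Pi.basisFun ℝ (Fin r)))

/-- The vertices `e_0 = 0, e_1, …, e_r` of the standard basic lattice simplex in `ℝ ^ r`. -/
def simplexVertex (r : ℕ) : Fin (r + 1) → (Fin r → ℝ) :=
  Fin.cons 0 fun i => Pi.single i 1

/-- The Cayley polytope `Δ_0 * ⋯ * Δ_r`: the convex hull of `(Δ_0, e_0), …, (Δ_r, e_r)`. -/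
def cayleyPolytope {E : Type*} [AddCommGroup E] [Module ℝ E] {r : ℕ}
    (Δ : Fin (r + 1) → Set E) : Set (E × (Fin r → ℝ)) :=
  convexHull ℝ (⋃ i, Δ i ×ˢ {simplexVertex r i})

/-- `Δ_0 * ⋯ * Δ_r` is an `r`-fold pyramid over `Δ_0`: the polytopes `Δ_1, …, Δ_r` are
zero-dimensional. -/
def IsPyramidFamily {E : Type*} [AddCommGroup E] [Module ℝ E] {r : ℕ}
    (Δ : Fin (r + 1) → Set E) : Prop :=
  ∀ i : Fin r, polytopeDim (Δ i.succ) = 0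

/-!
The lattice points of the dilates of the Cayley polytope are the lattice points, graded by height,
of the cone generated by the vectors `(v, e_i)` in `E × ℝ ^ (r + 1)`, where `v` runs over points
spanning `Δ_i` and `e_0, …, e_r` is now the standard basis (`ehrhartSeries_cayleyPolytope`). The
span of this cone has dimension `D = d + r + 1`, with `d = dim (Δ_0 + ⋯ + Δ_r)`, and the Cayley
polytope has dimension `d + r`. So the `h^*`-series is `(1 - t) ^ D` times the counting series of
the cone.

Ehrhart reciprocity is not needed to bound its degree; a half-open triangulation suffices. A
generic positive cost on the generators singles out the bases of generators with positive reduced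
costs. For a generic `q` in the interior of the cone and `x` in the cone, the point `x + ε q` with
small `ε > 0` lies in the open simplicial cone over exactly one of these bases: existence is
Carathéodory's theorem and the choice of the cheapest representation, uniqueness is weak linear
programming duality. This cuts the cone into disjoint half-open simplicial cones
(`existsUnique_isOptimal_inHalfOpenCone`). Each lattice point of such a cone is uniquely a lattice
point of a fundamental box plus a natural combination of the `D` generators, all of height `1`, so
multiplication by `(1 - t) ^ D` leaves the polynomial that counts the box points by height.

Give the generator `(v, e_i)` the colour `i`. As `q` lies inside the cone, its degree in each colour
is positive, so for each colour some generator of the basis has a positive coordinate at `q`, and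
its coefficient in a box point is less than `1`; all other coefficients are at most `1`. The degree
of a box point in a colour is an integer, hence smaller than the number of generators of that
colour. Summing over the `r + 1` colours, box points have height at most `D - (r + 1) = d`
(`SubBasis.InBox.degree_add_card_le`, `exists_polynomial_eq_coneSeries`).

For a pyramid over `Δ_0`, the lattice points of the cone are those of the dilates of `Δ_0` together
with `r` free natural numbers, the multiplicities of the apices. The Ehrhart series is thus divided
by `(1 - t) ^ r` while the dimension grows by `r`, and the two `h^*`-series coincide.
-/

/-! ### Counting series of graded sets -/

/-- The generating function `∑ k, #{s | d s = k} t ^ k` of a set `S` graded by `d : S → ℕ`.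
It is meaningful when the fibres of `d` are finite: `Nat.card` of an infinite fibre is `0`. -/
noncomputable def countingSeries {S : Type*} (d : S → ℕ) : ℤ⟦X⟧ :=
  PowerSeries.mk fun k => (Nat.card {s // d s = k} : ℤ)

theorem countingSeries_congr {S T : Type*} {d : S → ℕ} {d' : T → ℕ} (e : S ≃ T)
    (h : ∀ s, d' (e s) = d s) : countingSeries d = countingSeries d' := by
  ext k
  simp only [countingSeries, PowerSeries.coeff_mk]
  rw [Nat.card_congr (e.subtypeEquiv (q := fun t => d' t = k) fun s => by rw [h])]

theorem countingSeries_prod {S T : Type*} {d : S → ℕ} {d' : T → ℕ}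
    (h : ∀ k, Finite {s // d s = k}) (h' : ∀ k, Finite {s // d' s = k}) :
    countingSeries (fun p : S × T => d p.1 + d' p.2) = countingSeries d * countingSeries d' := by
  ext k
  simp only [countingSeries, PowerSeries.coeff_mk, PowerSeries.coeff_mul]
  let e : {p : S × T // d p.1 + d' p.2 = k} ≃
      Σ a : Finset.HasAntidiagonal.antidiagonal k, {s // d s = a.1.1} × {t // d' t = a.1.2} :=
    { toFun := fun p => ⟨⟨(d p.1.1, d' p.1.2), by simpa using p.2⟩, ⟨p.1.1, rfl⟩, ⟨p.1.2, rfl⟩⟩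
      invFun := fun q => ⟨(q.2.1.1, q.2.2.1), by
        rw [q.2.1.2, q.2.2.2]; exact Finset.HasAntidiagonal.mem_antidiagonal.1 q.1.2⟩
      left_inv := fun p => rfl
      right_inv := by
        rintro ⟨⟨⟨a, b⟩, hab⟩, ⟨s, hs⟩, ⟨t, ht⟩⟩
        simp only at hs ht
        subst hs ht
        rfl }
  rw [Nat.card_congr e, Nat.card_sigma]
  simp only [Nat.card_prod]
  push_cast
  exact Finset.sum_coe_sort (Finset.HasAntidiagonal.antidiagonal k)
    (fun a => (Nat.card {s // d s = a.1} : ℤ) * (Nat.card {t // d' t = a.2} : ℤ))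

theorem countingSeries_sigma {K : Type*} [Fintype K] {S : K → Type*} (d : ∀ i, S i → ℕ)
    (h : ∀ i k, Finite {s // d i s = k}) :
    countingSeries (fun p : Σ i, S i => d p.1 p.2) = ∑ i, countingSeries (d i) := by
  ext k
  simp only [countingSeries, PowerSeries.coeff_mk, map_sum]
  let e : {p : Σ i, S i // d p.1 p.2 = k} ≃ Σ i, {s // d i s = k} :=
    { toFun := fun p => ⟨p.1.1, p.1.2, p.2⟩
      invFun := fun q => ⟨⟨q.1, q.2.1⟩, q.2.2⟩
      left_inv := fun p => rfl
      right_inv := fun q => rfl }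
  rw [Nat.card_congr e, Nat.card_sigma]
  push_cast
  rfl

theorem countingSeries_id : countingSeries (fun n : ℕ => n) = PowerSeries.mk 1 := by
  ext k
  simp [countingSeries]

theorem finite_sum_fiber (ι : Type*) [Fintype ι] (k : ℕ) :
    Finite {n : ι → ℕ // ∑ i, n i = k} := by
  have : {n : ι → ℕ | ∑ i, n i = k} ⊆ Set.Icc 0 (fun _ => k) := by
    intro n hn
    refine ⟨fun i => Nat.zero_le _, fun i => ?_⟩
    rw [← (show _ = k from hn)]
    exact Finset.single_le_sum (fun _ _ => Nat.zero_le _) (Finset.mem_univ i)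
  classical
  exact ((Set.finite_Icc _ _).subset this).to_subtype

theorem one_sub_pow_mul_countingSeries_sum (ι : Type*) [Fintype ι] :
    (1 - PowerSeries.X) ^ Fintype.card ι * countingSeries (fun n : ι → ℕ => ∑ i, n i) = 1 := by
  suffices H : ∀ m : ℕ, (1 - PowerSeries.X) ^ m *
      countingSeries (fun n : Fin m → ℕ => ∑ i, n i) = 1 by
    refine Eq.trans ?_ (H (Fintype.card ι))
    congr 1
    exact countingSeries_congr (d' := fun n : Fin (Fintype.card ι) → ℕ => ∑ i, n i)
      (Equiv.arrowCongr (Fintype.equivFin ι) (Equiv.refl ℕ))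
      (fun n => Equiv.sum_comp (Fintype.equivFin ι).symm n)
  intro m
  induction m with
  | zero =>
    ext k
    simp only [countingSeries, pow_zero, one_mul, PowerSeries.coeff_mk, PowerSeries.coeff_one,
      Finset.univ_eq_empty, Finset.sum_empty]
    split_ifs with hk
    · subst hk
      simp
    · have : IsEmpty {n : Fin 0 → ℕ // 0 = k} := ⟨fun n => hk n.2.symm⟩
      simp
  | succ m ih =>
    have : countingSeries (fun n : Fin (m + 1) → ℕ => ∑ i, n i) =
        PowerSeries.mk 1 * countingSeries (fun n : Fin m → ℕ => ∑ i, n i) := by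
      rw [← countingSeries_id, ← countingSeries_prod (fun k => ?_) (finite_sum_fiber _)]
      · refine (countingSeries_congr (Fin.consEquiv fun _ => ℕ) fun p => ?_).symm
        simp [Fin.sum_univ_succ, Fin.consEquiv]
      · exact Finite.of_injective (fun _ => ()) fun a b _ => Subtype.ext (a.2.trans b.2.symm)
    rw [this, pow_succ, mul_assoc, ← mul_assoc (1 - PowerSeries.X) (PowerSeries.mk 1),
      mul_comm (1 - PowerSeries.X) (PowerSeries.mk 1),
      PowerSeries.mk_one_mul_one_sub_eq_one, one_mul, ih]

/-- Adjoining free generators of degree `1`, indexed by `ι`, divides a counting series by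
`(1 - t) ^ #ι`. -/
theorem one_sub_pow_mul_countingSeries_prod {S : Type*} {d : S → ℕ} (ι : Type*) [Fintype ι]
    (h : ∀ k, Finite {s // d s = k}) :
    (1 - PowerSeries.X) ^ Fintype.card ι *
      countingSeries (fun p : S × (ι → ℕ) => d p.1 + ∑ i, p.2 i) = countingSeries d := by
  rw [countingSeries_prod h (finite_sum_fiber ι), mul_left_comm,
    one_sub_pow_mul_countingSeries_sum, mul_one]

theorem exists_polynomial_eq_countingSeries {S : Type*} [Finite S] (d : S → ℕ) {N : ℕ}
    (hd : ∀ s, d s ≤ N) :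
    ∃ h : ℤ[X], h.natDegree ≤ N ∧ (h : ℤ⟦X⟧) = countingSeries d := by
  classical
  have := Fintype.ofFinite S
  refine ⟨∑ s : S, Polynomial.X ^ d s, ?_, ?_⟩
  · refine Polynomial.natDegree_sum_le_of_forall_le _ _ fun s _ => ?_
    simpa using hd s
  · ext k
    simp only [countingSeries, PowerSeries.coeff_mk, Polynomial.coeff_coe,
      Polynomial.finsetSum_coeff, Polynomial.coeff_X_pow]
    rw [Finset.sum_boole, Nat.card_eq_fintype_card, Fintype.card_subtype]
    simp only [eq_comm]

/-! ### Triangulating a cone by a generic cost function -/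

theorem exists_pos_forall_sum_mul_ne_zero {ι J : Type*} [Fintype ι] [Finite J] (a : J → ι → ℝ)
    (ha : ∀ j, a j ≠ 0) : ∃ m : ι → ℝ, (∀ i, 0 < m i) ∧ ∀ j, ∑ i, a j i * m i ≠ 0 := by
  classical
  have := Fintype.ofFinite J
  -- Look for `m` on the moment curve: each sum is then a nonzero polynomial in the parameter.
  let e := Fintype.equivFin ι
  let P : J → ℝ[X] := fun j => ∑ i, Polynomial.C (a j i) * Polynomial.X ^ (e i : ℕ)
  have hP : ∀ j, P j ≠ 0 := by
    intro j hj
    refine ha j (funext fun i => ?_)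
    have h := congrArg (fun p => Polynomial.coeff p (e i : ℕ)) hj
    simpa [P, Polynomial.finsetSum_coeff, Polynomial.coeff_X_pow, Fin.val_inj] using h
  have hQ : (∏ j, P j) ≠ 0 := Finset.prod_ne_zero_iff.2 fun j _ => hP j
  obtain ⟨t, ht, ht'⟩ : ∃ t : ℝ, 0 < t ∧ ¬ (∏ j, P j).IsRoot t := by
    by_contra! hcon
    exact hQ (Polynomial.eq_zero_of_infinite_isRoot _ ((Set.Ioi_infinite (0 : ℝ)).mono hcon))
  refine ⟨fun i => t ^ (e i : ℕ), fun i => pow_pos ht _, fun j hj => ht' ?_⟩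
  rw [Polynomial.IsRoot, Polynomial.eval_prod]
  refine Finset.prod_eq_zero (Finset.mem_univ j) ?_
  simpa [P, Polynomial.eval_finsetSum] using hj

section Triangulation

variable {ι W : Type*} [AddCommGroup W] [Module ℝ W] {g : ι → W}

/-- A subfamily of `g`, given by its set of indices, that is a basis of the ambient space. -/
structure SubBasis (g : ι → W) where
  /-- The set of indices of the subfamily. -/
  carrier : Finset ι
  linearIndepOn : LinearIndepOn ℝ g (carrier : Set ι)
  span_eq_top : Submodule.span ℝ (g '' (carrier : Set ι)) = ⊤

namespace SubBasis

theorem carrier_injective : Function.Injective (SubBasis.carrier (g := g)) := by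
  rintro ⟨B, _, _⟩ ⟨B', _, _⟩ h
  cases h
  rfl

instance [Finite ι] : Finite (SubBasis g) := Finite.of_injective _ carrier_injective

/-- The basis of the ambient space formed by the vectors of a sub-basis. -/
noncomputable def basis (b : SubBasis g) : Module.Basis b.carrier ℝ W :=
  Module.Basis.mk (v := fun i : b.carrier => g i) b.linearIndepOn
    (by rw [← b.span_eq_top, Set.image_eq_range]; rfl)

@[simp] theorem basis_apply (b : SubBasis g) (i : b.carrier) : b.basis i = g i := by
  exact Module.Basis.mk_apply _ _ i

theorem card_carrier (b : SubBasis g) : b.carrier.card = Module.finrank ℝ W := by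
  rw [Module.finrank_eq_card_basis b.basis, Fintype.card_coe]

open Classical in
/-- The coordinates of a vector in a sub-basis, extended by zero to all indices. -/
noncomputable def coord (b : SubBasis g) : W →ₗ[ℝ] ι → ℝ :=
  LinearMap.pi fun i => if h : i ∈ b.carrier then b.basis.coord ⟨i, h⟩ else 0

theorem coord_of_notMem (b : SubBasis g) (x : W) {i : ι} (hi : i ∉ b.carrier) :
    b.coord x i = 0 := by
  simp [coord, hi]

variable [Fintype ι]

theorem sum_coord_smul (b : SubBasis g) (x : W) : ∑ i, b.coord x i • g i = x := by
  classical
  conv_rhs => rw [← b.basis.sum_repr x]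
  rw [← Finset.sum_subset (Finset.subset_univ b.carrier)
    (fun i _ hi => by rw [b.coord_of_notMem x hi, zero_smul]), ← Finset.sum_coe_sort b.carrier]
  refine Finset.sum_congr rfl fun i _ => ?_
  simp [coord]

theorem coord_sum_smul (b : SubBasis g) {l : ι → ℝ} (hl : ∀ i ∉ b.carrier, l i = 0) :
    b.coord (∑ i, l i • g i) = l := by
  classical
  have h0 : ∑ i ∈ b.carrier, (b.coord (∑ i, l i • g i) i - l i) • g i = 0 := by
    rw [Finset.sum_subset (Finset.subset_univ b.carrier)
      (fun i _ hi => by rw [b.coord_of_notMem _ hi, hl i hi, sub_zero, zero_smul])]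
    simp only [sub_smul, Finset.sum_sub_distrib, sum_coord_smul, sub_self]
  funext i
  by_cases hi : i ∈ b.carrier
  · exact sub_eq_zero.1 (linearIndepOn_finset_iff.1 b.linearIndepOn _ h0 i hi)
  · rw [b.coord_of_notMem _ hi, hl i hi]

theorem coord_apply_self (b : SubBasis g) [DecidableEq ι] {i : ι} (hi : i ∈ b.carrier) :
    b.coord (g i) = Pi.single i 1 := by
  have h := b.coord_sum_smul (l := Pi.single i 1) fun j hj =>
    Pi.single_eq_of_ne (fun h => hj (by rwa [h])) _
  rwa [Fintype.sum_eq_single i (fun j hj => by rw [Pi.single_eq_of_ne hj, zero_smul]),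
    Pi.single_eq_same, one_smul] at h

end SubBasis

variable [Fintype ι]

/-- Carathéodory's theorem for cones, without increasing a given positive cost. -/
theorem exists_linearIndepOn_support_of_nonneg {w : ι → ℝ} (hw : ∀ i, 0 < w i) (l : ι → ℝ)
    (hl : ∀ i, 0 ≤ l i) : ∃ l' : ι → ℝ, (∀ i, 0 ≤ l' i) ∧ ∑ i, l' i • g i = ∑ i, l i • g i ∧
      ∑ i, w i * l' i ≤ ∑ i, w i * l i ∧ LinearIndepOn ℝ g {i | l' i ≠ 0} := by
  classical
  induction hn : (Finset.univ.filter fun i => l i ≠ 0).card using Nat.strong_induction_on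
    generalizing l with
  | _ n ih =>
  by_cases hLI : LinearIndepOn ℝ g {i | l i ≠ 0}
  · exact ⟨l, hl, rfl, le_rfl, hLI⟩
  -- A linear relation along which the cost does not increase.
  obtain ⟨a, ha0, hasupp, hasum, hacost⟩ : ∃ a : ι → ℝ, a ≠ 0 ∧ (∀ i, l i = 0 → a i = 0) ∧
      ∑ i, a i • g i = 0 ∧ ∑ i, w i * a i ≤ 0 := by
    have hset : {i | l i ≠ 0} = ((Finset.univ.filter fun i => l i ≠ 0 : Finset ι) : Set ι) := by
      ext; simp
    rw [hset, linearIndepOn_finset_iff] at hLI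
    push Not at hLI
    obtain ⟨f, hf, i, hi, hfi⟩ := hLI
    rw [Finset.sum_filter] at hf
    have hi' : l i ≠ 0 := by simpa using hi
    have key : ∀ s : ℝ, s ≠ 0 → s * ∑ i, w i * (if l i ≠ 0 then f i else 0) ≤ 0 →
        ∃ a : ι → ℝ, a ≠ 0 ∧ (∀ i, l i = 0 → a i = 0) ∧
        ∑ i, a i • g i = 0 ∧ ∑ i, w i * a i ≤ 0 := by
      intro s hs hle
      refine ⟨fun i => s * if l i ≠ 0 then f i else 0, fun h => ?_, fun j hj => by simp [hj],
        ?_, ?_⟩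
      · have := congrFun h i
        simp [hi', hs, hfi] at this
      · have h := congrArg (s • ·) hf
        rw [smul_zero, Finset.smul_sum] at h
        refine Eq.trans (Finset.sum_congr rfl fun j _ => ?_) h
        by_cases hj : l j = 0 <;> simp [hj, mul_smul]
      · rw [Finset.mul_sum] at hle
        refine le_of_eq_of_le (Finset.sum_congr rfl fun j _ => ?_) hle
        ring
    rcases le_total (∑ i, w i * (if l i ≠ 0 then f i else 0)) 0 with h | h
    · exact key 1 one_ne_zero (by linarith)
    · exact key (-1) (by norm_num) (by linarith)
  obtain ⟨i₁, hi₁⟩ : ∃ i, a i < 0 := by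
    by_contra! hcon
    obtain ⟨j, hj⟩ := Function.ne_iff.1 ha0
    refine hacost.not_gt (Finset.sum_pos' (fun i _ => mul_nonneg (hw i).le (hcon i))
      ⟨j, Finset.mem_univ j, mul_pos (hw j) (lt_of_le_of_ne (hcon j) (Ne.symm hj))⟩)
  -- Move along the relation until a coefficient vanishes.
  obtain ⟨i₀, hi₀, hmin⟩ := Finset.exists_min_image (Finset.univ.filter fun i => a i < 0)
    (fun i => l i / -a i) ⟨i₁, by simpa using hi₁⟩
  have hai₀ : a i₀ < 0 := by simpa using hi₀
  set t := l i₀ / -a i₀ with ht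
  have ht0 : 0 ≤ t := div_nonneg (hl i₀) (by linarith)
  have hvan : l i₀ + t * a i₀ = 0 := by
    have := hai₀.ne
    rw [ht]; field_simp; ring
  have hnn : ∀ i, 0 ≤ l i + t * a i := by
    intro i
    rcases lt_or_ge (a i) 0 with h | h
    · have h1 := hmin i (by simpa using h)
      rw [le_div_iff₀ (by linarith)] at h1
      linarith
    · exact add_nonneg (hl i) (mul_nonneg ht0 h)
  have hlt : (Finset.univ.filter fun i => l i + t * a i ≠ 0).card < n := by
    rw [← hn]
    refine Finset.card_lt_card (Finset.ssubset_iff_of_subset ?_ |>.2 ⟨i₀, ?_, ?_⟩)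
    · intro i hi
      simp only [Finset.mem_filter, Finset.mem_univ, true_and] at hi ⊢
      intro h
      exact hi (by rw [h, hasupp i h]; simp)
    · simp only [Finset.mem_filter, Finset.mem_univ, true_and]
      exact fun h => hai₀.ne (hasupp i₀ h)
    · simp [hvan]
  obtain ⟨l', h1, h2, h3, h4⟩ := ih _ hlt (fun i => l i + t * a i) hnn rfl
  refine ⟨l', h1, h2.trans ?_, h3.trans ?_, h4⟩
  · simp only [add_smul, mul_smul, Finset.sum_add_distrib, ← Finset.smul_sum, hasum, smul_zero,
      add_zero]
  · have : ∑ i, w i * (l i + t * a i) = ∑ i, w i * l i + t * ∑ i, w i * a i := by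
      rw [Finset.mul_sum, ← Finset.sum_add_distrib]
      exact Finset.sum_congr rfl fun i _ => by ring
    rw [this]
    nlinarith

/-- A vector is generic when the spans of subfamilies of `g` that contain it are the whole
space. -/
def IsGenericFor (g : ι → W) (y : W) : Prop :=
  ∀ S : Finset ι, y ∈ Submodule.span ℝ (g '' (S : Set ι)) →
    Submodule.span ℝ (g '' (S : Set ι)) = ⊤

/-- The cost `w` is generic when no generator outside a sub-basis has reduced cost zero. -/
def IsGenericCost (g : ι → W) (w : ι → ℝ) : Prop :=
  ∀ b : SubBasis g, ∀ i ∉ b.carrier, w i ≠ ∑ j, w j * b.coord (g i) j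

/-- A sub-basis is optimal for the cost `w` when all generators outside it have positive reduced
cost. For generic `w`, the cones over the optimal sub-bases triangulate the cone over `g`. -/
def SubBasis.IsOptimal (b : SubBasis g) (w : ι → ℝ) : Prop :=
  ∀ i ∉ b.carrier, ∑ j, w j * b.coord (g i) j < w i

theorem exists_isOptimal {w : ι → ℝ} (hw : ∀ i, 0 < w i) (hwg : IsGenericCost g w)
    {y : W} (hy : IsGenericFor g y) {l : ι → ℝ} (hl : ∀ i, 0 ≤ l i) (hly : ∑ i, l i • g i = y) :
    ∃ b : SubBasis g, b.IsOptimal w ∧ ∀ i ∈ b.carrier, 0 < b.coord y i := by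
  classical
  have H : ∀ l : ι → ℝ, (∀ i, 0 ≤ l i) → ∑ i, l i • g i = y →
      ∃ b : SubBasis g, (∀ i ∈ b.carrier, 0 < b.coord y i) ∧
        ∑ i, w i * b.coord y i ≤ ∑ i, w i * l i := by
    intro l hl hly
    obtain ⟨l', h1, h2, h3, h4⟩ := exists_linearIndepOn_support_of_nonneg (g := g) hw l hl
    have hset : {i | l' i ≠ 0} = ((Finset.univ.filter fun i => l' i ≠ 0 : Finset ι) : Set ι) := by
      ext; simp
    rw [hset] at h4
    have hmem : y ∈ Submodule.span ℝ
        (g '' ((Finset.univ.filter fun i => l' i ≠ 0 : Finset ι) : Set ι)) := by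
      rw [← hly, ← h2]
      refine Submodule.sum_mem _ fun i _ => ?_
      by_cases hi : l' i = 0
      · simp [hi]
      · exact Submodule.smul_mem _ _ (Submodule.subset_span ⟨i, by simpa using hi, rfl⟩)
    let b : SubBasis g := ⟨_, h4, hy _ hmem⟩
    have hb : b.coord y = l' := by
      rw [← hly, ← h2]
      exact b.coord_sum_smul fun i hi => by simpa [b] using hi
    refine ⟨b, fun i hi => ?_, by rw [hb]; exact h3⟩
    rw [hb]
    have hi' : l' i ≠ 0 := by simpa [b] using hi
    exact lt_of_le_of_ne (h1 i) hi'.symm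
  obtain ⟨b₀, hb₀, -⟩ := H l hl hly
  obtain ⟨b, hb, hmin⟩ := Set.exists_min_image
    {b : SubBasis g | ∀ i ∈ b.carrier, 0 < b.coord y i} (fun b => ∑ i, w i * b.coord y i)
    (Set.toFinite _) ⟨b₀, hb₀⟩
  refine ⟨b, fun i hi => ?_, hb⟩
  by_contra hcon
  have hlt : w i < ∑ j, w j * b.coord (g i) j := lt_of_le_of_ne (not_lt.1 hcon) (hwg b i hi)
  -- Otherwise, letting the generator `i` enter the basis would decrease the cost.
  obtain ⟨s, hs0, hs⟩ : ∃ s : ℝ, 0 < s ∧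
      ∀ j ∈ b.carrier, 0 < b.coord y j - s * b.coord (g i) j := by
    have h : ∀ᶠ s in nhdsWithin (0 : ℝ) (Set.Ioi 0),
        ∀ j ∈ b.carrier, 0 < b.coord y j - s * b.coord (g i) j := by
      rw [Filter.eventually_all_finset]
      intro j hj
      have hc : ContinuousAt (fun s : ℝ => b.coord y j - s * b.coord (g i) j) 0 := by fun_prop
      exact (hc.eventually (lt_mem_nhds (by simpa using hb j hj))).filter_mono
        nhdsWithin_le_nhds
    obtain ⟨s, h1, h2⟩ := (h.and self_mem_nhdsWithin).exists
    exact ⟨s, h2, h1⟩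
  have hnn : ∀ j, 0 ≤ b.coord y j + s * ((Pi.single i 1 : ι → ℝ) j - b.coord (g i) j) := by
    intro j
    by_cases hj : j ∈ b.carrier
    · have := hs j hj
      rw [Pi.single_eq_of_ne (fun h => hi (by rwa [← h]))]
      linarith
    · rw [b.coord_of_notMem y hj, b.coord_of_notMem _ hj, sub_zero, zero_add]
      refine mul_nonneg hs0.le ?_
      by_cases h : j = i
      · subst h; simp
      · simp [Pi.single_eq_of_ne h]
  have hrep : ∑ j, (b.coord y j + s * ((Pi.single i 1 : ι → ℝ) j - b.coord (g i) j)) • g j = y := by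
    simp only [add_smul, mul_smul, sub_smul, Finset.sum_add_distrib, ← Finset.smul_sum,
      Finset.sum_sub_distrib, b.sum_coord_smul]
    rw [Fintype.sum_eq_single i (fun j hj => by rw [Pi.single_eq_of_ne hj, zero_smul])]
    simp
  obtain ⟨b', hb', hle⟩ := H _ hnn hrep
  have h1 := hmin b' hb'
  have h2 : ∑ j, w j * (b.coord y j + s * ((Pi.single i 1 : ι → ℝ) j - b.coord (g i) j)) =
      ∑ j, w j * b.coord y j + s * (w i - ∑ j, w j * b.coord (g i) j) := by
    have h3 : w i = ∑ j, w j * (Pi.single i 1 : ι → ℝ) j := by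
      rw [Fintype.sum_eq_single i (fun j hj => by rw [Pi.single_eq_of_ne hj, mul_zero])]
      simp
    rw [h3, ← Finset.sum_sub_distrib, Finset.mul_sum, ← Finset.sum_add_distrib]
    exact Finset.sum_congr rfl fun j _ => by ring
  rw [h2] at hle
  nlinarith

/-- Weak duality: an optimal sub-basis represents its vectors at the least cost. -/
theorem SubBasis.IsOptimal.sum_mul_coord_le {w : ι → ℝ} {b : SubBasis g} (hb : b.IsOptimal w)
    {l : ι → ℝ} (hl : ∀ i, 0 ≤ l i) :
    ∑ i, w i * b.coord (∑ i, l i • g i) i ≤ ∑ i, w i * l i ∧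
      ((∃ i, i ∉ b.carrier ∧ 0 < l i) →
        ∑ i, w i * b.coord (∑ i, l i • g i) i < ∑ i, w i * l i) := by
  classical
  have h1 : ∑ i, w i * b.coord (∑ i, l i • g i) i = ∑ k, l k * ∑ i, w i * b.coord (g k) i := by
    simp only [map_sum, map_smul, Finset.sum_apply, Pi.smul_apply, smul_eq_mul, Finset.mul_sum]
    rw [Finset.sum_comm]
    exact Finset.sum_congr rfl fun k _ => Finset.sum_congr rfl fun i _ => by ring
  have h2 : ∀ k, ∑ i, w i * b.coord (g k) i ≤ w k := by
    intro k
    by_cases hk : k ∈ b.carrier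
    · rw [b.coord_apply_self hk,
        Fintype.sum_eq_single k (fun j hj => by rw [Pi.single_eq_of_ne hj, mul_zero])]
      simp
    · exact (hb k hk).le
  have h3 : ∀ k, l k * ∑ i, w i * b.coord (g k) i ≤ w k * l k := fun k => by
    rw [mul_comm]; exact mul_le_mul_of_nonneg_right (h2 k) (hl k)
  rw [h1]
  refine ⟨Finset.sum_le_sum fun k _ => h3 k, ?_⟩
  rintro ⟨k, hk, hlk⟩
  refine Finset.sum_lt_sum (fun k _ => h3 k) ⟨k, Finset.mem_univ k, ?_⟩
  rw [mul_comm]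
  exact mul_lt_mul_of_pos_right (hb k hk) hlk

theorem SubBasis.IsOptimal.eq_of_coord_pos {w : ι → ℝ} {y : W} {b b' : SubBasis g}
    (hb : b.IsOptimal w) (hb' : b'.IsOptimal w) (hy : ∀ i ∈ b.carrier, 0 < b.coord y i)
    (hy' : ∀ i ∈ b'.carrier, 0 < b'.coord y i) : b = b' := by
  have nn : ∀ b : SubBasis g, (∀ i ∈ b.carrier, 0 < b.coord y i) → ∀ i, 0 ≤ b.coord y i := by
    intro b hb i
    by_cases hi : i ∈ b.carrier
    · exact (hb i hi).le
    · rw [b.coord_of_notMem y hi]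
  have h1 := hb.sum_mul_coord_le (nn b' hy')
  have h2 := hb'.sum_mul_coord_le (nn b hy)
  rw [SubBasis.sum_coord_smul] at h1 h2
  refine SubBasis.carrier_injective (Finset.Subset.antisymm ?_ ?_)
  · intro i hi
    by_contra hi'
    exact (h2.2 ⟨i, hi', hy i hi⟩).not_ge h1.1
  · intro i hi
    by_contra hi'
    exact (h1.2 ⟨i, hi', hy' i hi⟩).not_ge h2.1

/-- Membership in the half-open simplicial cone over the sub-basis `b`: the facets missing are
those that separate the cone from `q`. Equivalently, `x + ε • q` is in the interior of the cone
for all small `ε > 0`. -/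
def SubBasis.InHalfOpenCone (b : SubBasis g) (q x : W) : Prop :=
  ∀ i ∈ b.carrier, 0 < b.coord x i ∨ (b.coord x i = 0 ∧ 0 < b.coord q i)

/-- Generic directions move every vector into generic position at once. -/
theorem eventually_isGenericFor_add_smul {q : W} (hq : IsGenericFor g q) (x : W) :
    ∀ᶠ s in nhdsWithin (0 : ℝ) (Set.Ioi 0), IsGenericFor g (x + s • q) := by
  refine Filter.eventually_all.2 fun S => ?_
  by_cases htop : Submodule.span ℝ (g '' (S : Set ι)) = ⊤
  · exact Filter.Eventually.of_forall fun _ _ => htop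
  -- The line through `x` in the direction `q` meets a proper span at most once.
  have hsub : {s : ℝ | x + s • q ∈ Submodule.span ℝ (g '' (S : Set ι))}.Subsingleton := by
    intro s hs t ht
    by_contra hst
    refine htop (hq S ?_)
    have h := Submodule.sub_mem _ (Set.mem_ofPred.1 hs) (Set.mem_ofPred.1 ht)
    rw [add_sub_add_left_eq_sub, ← sub_smul] at h
    exact (Submodule.smul_mem_iff _ (sub_ne_zero.2 hst)).1 h
  rcases hsub.eq_empty_or_singleton with h | ⟨s₀, h⟩
  · refine Filter.Eventually.of_forall fun s hs => ?_
    exact absurd (show s ∈ {s : ℝ | x + s • q ∈ Submodule.span ℝ (g '' (S : Set ι))} from hs)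
      (by rw [h]; simp)
  · have hne : ∀ᶠ s in nhdsWithin (0 : ℝ) (Set.Ioi 0), s ≠ s₀ := by
      rcases le_or_gt s₀ 0 with h0 | h0
      · filter_upwards [self_mem_nhdsWithin] with s hs
        exact (lt_of_le_of_lt h0 hs).ne'
      · filter_upwards [nhdsWithin_le_nhds (Iio_mem_nhds h0)] with s hs
        exact ne_of_lt hs
    filter_upwards [hne] with s hs hmem
    exact absurd (show s ∈ {s : ℝ | x + s • q ∈ Submodule.span ℝ (g '' (S : Set ι))} from hmem)
      (by rw [h]; simpa using hs)

theorem eventually_add_mul_pos_iff (a c : ℝ) :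
    ∀ᶠ s in nhdsWithin (0 : ℝ) (Set.Ioi 0), (0 < a + s * c ↔ 0 < a ∨ (a = 0 ∧ 0 < c)) := by
  have hcont : ContinuousAt (fun s : ℝ => a + s * c) 0 := by fun_prop
  rcases lt_trichotomy a 0 with h | h | h
  · filter_upwards [nhdsWithin_le_nhds (hcont.eventually (gt_mem_nhds (by simpa using h)))]
      with s hs
    constructor
    · intro h'; linarith
    · rintro (h' | h') <;> linarith
  · filter_upwards [self_mem_nhdsWithin] with s hs
    have hs : 0 < s := hs
    simp [h, hs]
  · filter_upwards [nhdsWithin_le_nhds (hcont.eventually (lt_mem_nhds (by simpa using h)))]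
      with s hs
    simp [h, hs]

/-- The cone over `g` is the disjoint union of the half-open cones over the optimal sub-bases. -/
theorem existsUnique_isOptimal_inHalfOpenCone {w : ι → ℝ} (hw : ∀ i, 0 < w i)
    (hwg : IsGenericCost g w) {q : W} (hq : IsGenericFor g q) {m : ι → ℝ} (hm : ∀ i, 0 ≤ m i)
    (hmq : ∑ i, m i • g i = q) {l : ι → ℝ} (hl : ∀ i, 0 ≤ l i) :
    ∃! b : SubBasis g, b.IsOptimal w ∧ b.InHalfOpenCone q (∑ i, l i • g i) := by
  set x := ∑ i, l i • g i with hx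
  have hev : ∀ᶠ s in nhdsWithin (0 : ℝ) (Set.Ioi 0), ∀ b : SubBasis g,
      (∀ i ∈ b.carrier, 0 < b.coord (x + s • q) i) ↔ b.InHalfOpenCone q x := by
    refine Filter.eventually_all.2 fun b => ?_
    have h : ∀ᶠ s in nhdsWithin (0 : ℝ) (Set.Ioi 0), ∀ i ∈ b.carrier,
        (0 < b.coord x i + s * b.coord q i ↔
          0 < b.coord x i ∨ (b.coord x i = 0 ∧ 0 < b.coord q i)) :=
      (Filter.eventually_all_finset _).2 fun i _ => eventually_add_mul_pos_iff _ _
    filter_upwards [h] with s hs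
    simp only [map_add, map_smul, Pi.add_apply, Pi.smul_apply, smul_eq_mul]
    exact forall₂_congr hs
  obtain ⟨s, ⟨hs, hgen⟩, hs0⟩ :=
    ((hev.and (eventually_isGenericFor_add_smul hq x)).and self_mem_nhdsWithin).exists
  have hs0 : 0 < s := hs0
  obtain ⟨b, hb, hby⟩ := exists_isOptimal hw hwg hgen (l := fun i => l i + s * m i)
    (fun i => add_nonneg (hl i) (mul_nonneg hs0.le (hm i)))
    (by simp only [add_smul, mul_smul, Finset.sum_add_distrib, ← Finset.smul_sum, hmq, ← hx])
  refine ⟨b, ⟨hb, (hs b).1 hby⟩, ?_⟩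
  rintro b' ⟨hb', hby'⟩
  exact hb'.eq_of_coord_pos hb ((hs b').2 hby') hby

theorem exists_isGenericCost (g : ι → W) : ∃ w : ι → ℝ, (∀ i, 0 < w i) ∧ IsGenericCost g w := by
  classical
  obtain ⟨w, hw, h⟩ := exists_pos_forall_sum_mul_ne_zero
    (J := {p : SubBasis g × ι // p.2 ∉ p.1.carrier})
    (fun p j => (Pi.single p.1.2 1 : ι → ℝ) j - p.1.1.coord (g p.1.2) j) (fun p hp => by
      have := congrFun hp p.1.2
      simp [p.1.1.coord_of_notMem _ p.2] at this)
  refine ⟨w, hw, fun b i hi heq => h ⟨(b, i), hi⟩ ?_⟩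
  simp only [sub_mul, Finset.sum_sub_distrib]
  rw [Fintype.sum_eq_single i (fun j hj => by rw [Pi.single_eq_of_ne hj, zero_mul]),
    Pi.single_eq_same, one_mul, heq]
  simp only [mul_comm, sub_self]

theorem exists_isGenericFor (hg : Submodule.span ℝ (Set.range g) = ⊤) :
    ∃ m : ι → ℝ, (∀ i, 0 < m i) ∧ IsGenericFor g (∑ i, m i • g i) := by
  classical
  have hf : ∀ S : {S : Finset ι // Submodule.span ℝ (g '' (S : Set ι)) ≠ ⊤},
      ∃ f : W →ₗ[ℝ] ℝ, f ≠ 0 ∧ Submodule.span ℝ (g '' (S.1 : Set ι)) ≤ LinearMap.ker f :=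
    fun S => Submodule.exists_le_ker_of_lt_top _ (lt_top_iff_ne_top.2 S.2)
  choose f hf0 hfker using hf
  obtain ⟨m, hm, h⟩ := exists_pos_forall_sum_mul_ne_zero (fun S i => f S (g i)) (fun S hS => by
    refine hf0 S (LinearMap.ext_on_range hg fun i => ?_)
    simpa using congrFun hS i)
  refine ⟨m, hm, fun S hS => ?_⟩
  by_contra htop
  refine h ⟨S, htop⟩ ?_
  have := hfker ⟨S, htop⟩ hS
  rw [LinearMap.mem_ker, map_sum] at this
  simpa [mul_comm] using this

end Triangulation

/-! ### Lattice points in half-open simplicial cones -/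

/-- The interval `[0, 1)` if `Q` holds, and `(0, 1]` otherwise. -/
def halfOpenUnit (Q : Prop) : Set ℝ :=
  {u | 0 ≤ u ∧ u ≤ 1 ∧ (Q → u < 1) ∧ (¬ Q → 0 < u)}

theorem exists_sub_natCast_mem_halfOpenUnit {Q : Prop} {a : ℝ} (h : 0 < a ∨ (a = 0 ∧ Q)) :
    ∃ n : ℕ, a - n ∈ halfOpenUnit Q := by
  have ha : 0 ≤ a := by rcases h with h | h <;> linarith
  by_cases hQ : Q
  · have h1 := Nat.floor_le ha
    have h2 := Nat.lt_floor_add_one a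
    exact ⟨⌊a⌋₊, by linarith, by linarith, fun _ => by linarith, fun h => absurd hQ h⟩
  · have ha' : 0 < a := h.resolve_right fun h => hQ h.2
    have h1 := Nat.le_ceil a
    have h2 := Nat.ceil_lt_add_one ha
    have h3 : (((⌈a⌉₊ - 1 : ℕ)) : ℝ) = ⌈a⌉₊ - 1 := by
      rw [Nat.cast_sub (Nat.one_le_iff_ne_zero.2 (Nat.ceil_pos.2 ha').ne'), Nat.cast_one]
    exact ⟨⌈a⌉₊ - 1, by linarith, by linarith, fun h => absurd h hQ, fun _ => by linarith⟩

theorem natCast_eq_of_mem_halfOpenUnit {Q : Prop} {u v : ℝ} (hu : u ∈ halfOpenUnit Q)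
    (hv : v ∈ halfOpenUnit Q) {n m : ℕ} (h : u + n = v + m) : n = m := by
  have h1 : ((n : ℝ) < m + 1) ∧ ((m : ℝ) < n + 1) := by
    by_cases hQ : Q
    · have := hu.2.2.1 hQ
      have := hv.2.2.1 hQ
      have := hu.1
      have := hv.1
      constructor <;> linarith
    · have := hu.2.2.2 hQ
      have := hv.2.2.2 hQ
      have := hu.2.1
      have := hv.2.1
      constructor <;> linarith
  have h2 : n < m + 1 := by exact_mod_cast h1.1
  have h3 : m < n + 1 := by exact_mod_cast h1.2
  omega

/-- The convex cone generated by the family `g`. -/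
def posCone {ι W : Type*} [Fintype ι] [AddCommGroup W] [Module ℝ W] (g : ι → W) : Set W :=
  {x | ∃ l : ι → ℝ, (∀ i, 0 ≤ l i) ∧ ∑ i, l i • g i = x}

section Cone

variable {ι κ W : Type*}

section Algebra

variable [AddCommGroup W] [Module ℝ W] {g : ι → W}

theorem SubBasis.InHalfOpenCone.coord_nonneg {b : SubBasis g} {q x : W}
    (h : b.InHalfOpenCone q x) (i : ι) : 0 ≤ b.coord x i := by
  by_cases hi : i ∈ b.carrier
  · rcases h i hi with h | h <;> linarith
  · rw [b.coord_of_notMem x hi]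

variable [Fintype ι]

theorem SubBasis.InHalfOpenCone.mem_posCone {b : SubBasis g} {q x : W}
    (h : b.InHalfOpenCone q x) : x ∈ posCone g :=
  ⟨b.coord x, h.coord_nonneg, b.sum_coord_smul x⟩

/-- Membership in the fundamental parallelepiped of the half-open cone over `b`. -/
def SubBasis.InBox (b : SubBasis g) (q x : W) : Prop :=
  ∀ i ∈ b.carrier, b.coord x i ∈ halfOpenUnit (0 < b.coord q i)

theorem SubBasis.coord_add_sum_smul (b : SubBasis g) (x : W) (n : b.carrier → ℕ)
    (j : b.carrier) : b.coord (x + ∑ i, n i • g i) j = b.coord x j + n j := by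
  classical
  rw [map_add, map_sum, Pi.add_apply, Finset.sum_apply, Fintype.sum_eq_single j]
  · simp [b.coord_apply_self j.2]
  · intro i hi
    rw [map_nsmul, b.coord_apply_self i.2, Pi.smul_apply,
      Pi.single_eq_of_ne (fun h => hi (Subtype.ext h.symm)), smul_zero]

/-- Every lattice point of a half-open simplicial cone is, in a unique way, the sum of a lattice
point of the fundamental parallelepiped and of a combination of the generators with natural
coefficients. -/
noncomputable def SubBasis.boxEquiv (b : SubBasis g) (q : W) (Λ : Submodule ℤ W)
    (hg : ∀ i, g i ∈ Λ) :
    {x // x ∈ Λ ∧ b.InBox q x} × (b.carrier → ℕ) ≃ {x // x ∈ Λ ∧ b.InHalfOpenCone q x} :=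
  Equiv.ofBijective
    (fun p => ⟨p.1.1 + ∑ i, p.2 i • g i,
      Λ.add_mem p.1.2.1 (Λ.sum_mem fun i _ => Λ.smul_of_tower_mem (p.2 i) (hg i)), fun i hi => by
        have h := b.coord_add_sum_smul p.1.1 p.2 ⟨i, hi⟩
        simp only at h
        have hbox := p.1.2.2 i hi
        have hn : (0 : ℝ) ≤ p.2 ⟨i, hi⟩ := Nat.cast_nonneg _
        rw [h]
        by_cases hQ : 0 < b.coord q i
        · have h1 := hbox.1
          rcases (add_nonneg h1 hn).eq_or_lt with h2 | h2
          · exact Or.inr ⟨h2.symm, hQ⟩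
          · exact Or.inl h2
        · have h1 := hbox.2.2.2 hQ
          exact Or.inl (by linarith)⟩)
    (by
      constructor
      · rintro ⟨⟨x, hxΛ, hx⟩, n⟩ ⟨⟨y, hyΛ, hy⟩, m⟩ h
        have h : x + ∑ i, n i • g i = y + ∑ i, m i • g i := congrArg Subtype.val h
        have hnm : n = m := by
          funext j
          have h1 := b.coord_add_sum_smul x n j
          rw [h, b.coord_add_sum_smul y m j] at h1
          exact natCast_eq_of_mem_halfOpenUnit (hx j j.2) (hy j j.2) h1.symm
        subst hnm
        have := add_right_cancel h
        subst this
        rfl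
      · rintro ⟨x, hxΛ, hx⟩
        have h := fun i : b.carrier => exists_sub_natCast_mem_halfOpenUnit (hx i i.2)
        choose n hn using h
        refine ⟨⟨⟨x - ∑ i, n i • g i, Λ.sub_mem hxΛ (Λ.sum_mem fun i _ =>
          Λ.smul_of_tower_mem (n i) (hg i)), fun i hi => ?_⟩, n⟩, Subtype.ext ?_⟩
        · have h := b.coord_add_sum_smul (x - ∑ i, n i • g i) n ⟨i, hi⟩
          rw [sub_add_cancel] at h
          have h2 := hn ⟨i, hi⟩
          simp only at h h2
          rwa [h, add_sub_cancel_right] at h2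
        · exact sub_add_cancel _ _)

variable [DecidableEq κ] {color : ι → κ} {χ : W →ₗ[ℝ] κ → ℝ}

theorem map_sum_smul_apply (hχ : ∀ i, χ (g i) = Pi.single (color i) 1) (l : ι → ℝ) (k : κ) :
    χ (∑ i, l i • g i) k = ∑ i, if color i = k then l i else 0 := by
  rw [map_sum, Finset.sum_apply]
  refine Finset.sum_congr rfl fun i _ => ?_
  rw [map_smul, hχ, Pi.smul_apply, Pi.single_apply, smul_eq_mul, mul_ite, mul_one, mul_zero]
  simp only [eq_comm]

variable [Fintype κ]

theorem sum_map_sum_smul (hχ : ∀ i, χ (g i) = Pi.single (color i) 1) (l : ι → ℝ) :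
    ∑ k, χ (∑ i, l i • g i) k = ∑ i, l i := by
  simp only [map_sum_smul_apply hχ]
  rw [Finset.sum_comm]
  simp

theorem natCast_floor_degree {Λ : Submodule ℤ W} (hχ : ∀ i, χ (g i) = Pi.single (color i) 1)
    (hint : ∀ x ∈ Λ, ∀ k, ∃ n : ℤ, χ x k = n) {x : W} (hx : x ∈ Λ) (hxc : x ∈ posCone g) :
    ((⌊∑ k, χ x k⌋₊ : ℕ) : ℝ) = ∑ k, χ x k := by
  choose n hn using hint x hx
  obtain ⟨l, hl, rfl⟩ := hxc
  have h0 : 0 ≤ ∑ k, χ (∑ i, l i • g i) k := by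
    rw [sum_map_sum_smul hχ]
    exact Finset.sum_nonneg fun i _ => hl i
  have h1 : ∑ k, χ (∑ i, l i • g i) k = ((∑ k, n k : ℤ) : ℝ) := by
    push_cast
    exact Finset.sum_congr rfl fun k _ => hn k
  rw [h1] at h0 ⊢
  have h2 : 0 ≤ ∑ k, n k := by exact_mod_cast h0
  obtain ⟨m, hm⟩ := Int.eq_ofNat_of_zero_le h2
  rw [hm]
  simp

/-- Since `q` has positive degree in every colour, the half-open cone over `b` contains, for each
colour, one of the facets opposite to the generators of that colour. Thus the degree of a box
point in each colour, which is an integer, is less than the number of generators. -/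
theorem SubBasis.InBox.degree_add_card_le [FiniteDimensional ℝ W] {Λ : Submodule ℤ W}
    (hχ : ∀ i, χ (g i) = Pi.single (color i) 1)
    (hint : ∀ x ∈ Λ, ∀ k, ∃ n : ℤ, χ x k = n) {q : W} (hq : ∀ k, 0 < χ q k) {b : SubBasis g}
    {x : W} (hx : x ∈ Λ) (hxb : b.InBox q x) :
    ∑ k, χ x k + Fintype.card κ ≤ Module.finrank ℝ W := by
  have hχb : ∀ (y : W) (k : κ),
      χ y k = ∑ i ∈ b.carrier.filter (fun i => color i = k), b.coord y i := by
    intro y k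
    conv_lhs => rw [← b.sum_coord_smul y]
    rw [map_sum_smul_apply hχ, Finset.sum_filter]
    refine (Finset.sum_subset (Finset.subset_univ _) fun i _ hi => ?_).symm
    rw [b.coord_of_notMem y hi, ite_self]
  have key : ∀ k, χ x k + 1 ≤ ((b.carrier.filter (fun i => color i = k)).card : ℝ) := by
    intro k
    have hlt : χ x k < ((b.carrier.filter (fun i => color i = k)).card : ℝ) := by
      have hqk := hq k
      rw [hχb] at hqk
      obtain ⟨j, hj, hjq⟩ := Finset.exists_lt_of_sum_lt (s := b.carrier.filter fun i => color i = k)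
        (f := fun _ => (0 : ℝ)) (g := fun i => b.coord q i) (by simpa using hqk)
      rw [hχb, Finset.card_eq_sum_ones, Nat.cast_sum]
      push_cast
      refine Finset.sum_lt_sum (fun i hi => (hxb i (Finset.mem_filter.1 hi).1).2.1)
        ⟨j, hj, (hxb j (Finset.mem_filter.1 hj).1).2.2.1 hjq⟩
    obtain ⟨n, hn⟩ := hint x hx k
    rw [hn] at hlt ⊢
    exact_mod_cast hlt
  have hsum := Finset.sum_le_sum fun k (_ : k ∈ Finset.univ) => key k
  rw [Finset.sum_add_distrib] at hsum
  have hcard : ∑ k, (b.carrier.filter (fun i => color i = k)).card = Module.finrank ℝ W := by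
    rw [← b.card_carrier]
    exact (Finset.card_eq_sum_card_fiberwise (fun i _ => Finset.mem_coe.2 (Finset.mem_univ _))).symm
  rw [← hcard]
  push_cast
  simpa using hsum

end Algebra

variable [Fintype ι] [NormedAddCommGroup W] [NormedSpace ℝ W] {g : ι → W}

theorem isBounded_sum_smul (g : ι → W) (M : ℝ) :
    Bornology.IsBounded {x | ∃ l : ι → ℝ, (∀ i, 0 ≤ l i ∧ l i ≤ M) ∧ ∑ i, l i • g i = x} := by
  refine isBounded_iff_forall_norm_le.2 ⟨∑ i, M * ‖g i‖, ?_⟩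
  rintro _ ⟨l, hl, rfl⟩
  refine (norm_sum_le _ _).trans (Finset.sum_le_sum fun i _ => ?_)
  rw [norm_smul, Real.norm_of_nonneg (hl i).1]
  exact mul_le_mul_of_nonneg_right (hl i).2 (norm_nonneg _)

variable [Fintype κ] [DecidableEq κ] {color : ι → κ} {χ : W →ₗ[ℝ] κ → ℝ} {Λ : Submodule ℤ W}

theorem finite_degree_fiber (hΛ : ∀ s : Set W, Bornology.IsBounded s → (s ∩ Λ).Finite)
    (hχ : ∀ i, χ (g i) = Pi.single (color i) 1) (hint : ∀ x ∈ Λ, ∀ k, ∃ n : ℤ, χ x k = n)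
    (k : ℕ) : {x | (x ∈ Λ ∧ x ∈ posCone g) ∧ ⌊∑ c, χ x c⌋₊ = k}.Finite := by
  refine (hΛ _ (isBounded_sum_smul g k)).subset ?_
  rintro x ⟨⟨hx, hxc⟩, hk⟩
  have hdeg := natCast_floor_degree hχ hint hx hxc
  obtain ⟨l, hl, rfl⟩ := hxc
  refine ⟨⟨l, fun i => ⟨hl i, ?_⟩, rfl⟩, hx⟩
  rw [hk, sum_map_sum_smul hχ] at hdeg
  rw [hdeg]
  exact Finset.single_le_sum (fun i _ => hl i) (Finset.mem_univ i)

theorem finite_box (hΛ : ∀ s : Set W, Bornology.IsBounded s → (s ∩ Λ).Finite) (b : SubBasis g)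
    (q : W) : Finite {x // x ∈ Λ ∧ b.InBox q x} := by
  refine ((hΛ _ (isBounded_sum_smul g 1)).subset ?_).to_subtype
  rintro x ⟨hx, hxb⟩
  refine ⟨⟨b.coord x, fun i => ?_, b.sum_coord_smul x⟩, hx⟩
  by_cases hi : i ∈ b.carrier
  · exact ⟨(hxb i hi).1, (hxb i hi).2.1⟩
  · simp [b.coord_of_notMem x hi]

/-- The series counting the lattice points of a cone whose generators are coloured, graded by the
total degree, is a polynomial of degree at most the dimension minus the number of colours, divided
by a power of `1 - t`. -/
theorem exists_polynomial_eq_coneSeries [FiniteDimensional ℝ W]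
    (hΛ : ∀ s : Set W, Bornology.IsBounded s → (s ∩ Λ).Finite) (hg : ∀ i, g i ∈ Λ)
    (hspan : Submodule.span ℝ (Set.range g) = ⊤) (hcolor : Function.Surjective color)
    (hχ : ∀ i, χ (g i) = Pi.single (color i) 1) (hint : ∀ x ∈ Λ, ∀ k, ∃ n : ℤ, χ x k = n) :
    ∃ h : ℤ[X], h.natDegree ≤ Module.finrank ℝ W - Fintype.card κ ∧
      (h : ℤ⟦X⟧) = (1 - PowerSeries.X) ^ Module.finrank ℝ W *
        countingSeries (fun x : {x // x ∈ Λ ∧ x ∈ posCone g} => ⌊∑ k, χ x k⌋₊) := by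
  classical
  obtain ⟨w, hw, hwg⟩ := exists_isGenericCost g
  obtain ⟨m, hm, hq⟩ := exists_isGenericFor hspan
  set q := ∑ i, m i • g i with hmq
  have hqpos : ∀ k, 0 < χ q k := by
    intro k
    obtain ⟨i, hi⟩ := hcolor k
    rw [hmq, map_sum_smul_apply hχ]
    refine Finset.sum_pos' (fun i _ => ?_) ⟨i, Finset.mem_univ i, by simp [hi, hm i]⟩
    split_ifs
    exacts [(hm i).le, le_rfl]
  have := Fintype.ofFinite {b : SubBasis g // b.IsOptimal w}
  let e : (Σ b : {b : SubBasis g // b.IsOptimal w}, {x // x ∈ Λ ∧ b.1.InHalfOpenCone q x}) ≃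
      {x // x ∈ Λ ∧ x ∈ posCone g} :=
    Equiv.ofBijective (fun p => ⟨p.2.1, p.2.2.1, p.2.2.2.mem_posCone⟩) (by
      constructor
      · rintro ⟨⟨b, hb⟩, x, hx, hxb⟩ ⟨⟨b', hb'⟩, x', hx', hxb'⟩ h
        have h : x = x' := congrArg Subtype.val h
        subst h
        obtain ⟨l, hl, rfl⟩ := hxb.mem_posCone
        have := (existsUnique_isOptimal_inHalfOpenCone hw hwg hq (fun i => (hm i).le) hmq.symm
          hl).unique ⟨hb, hxb⟩ ⟨hb', hxb'⟩
        subst this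
        rfl
      · rintro ⟨x, hx, l, hl, rfl⟩
        obtain ⟨b, ⟨hb, hxb⟩, -⟩ := existsUnique_isOptimal_inHalfOpenCone hw hwg hq
          (fun i => (hm i).le) hmq.symm hl
        exact ⟨⟨⟨b, hb⟩, _, hx, hxb⟩, rfl⟩)
  have hfib : ∀ (b : SubBasis g) (k : ℕ),
      Finite {x : {x // x ∈ Λ ∧ b.InHalfOpenCone q x} // ⌊∑ c, χ x.1 c⌋₊ = k} := by
    intro b k
    have := (finite_degree_fiber hΛ hχ hint k).to_subtype
    exact Finite.of_injective
      (β := {x | (x ∈ Λ ∧ x ∈ posCone g) ∧ ⌊∑ c, χ x c⌋₊ = k})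
      (fun x => ⟨x.1.1, ⟨x.1.2.1, x.1.2.2.mem_posCone⟩, x.2⟩)
      fun x y h => by simpa [Subtype.ext_iff] using h
  have hcone : countingSeries (fun x : {x // x ∈ Λ ∧ x ∈ posCone g} => ⌊∑ k, χ x k⌋₊) =
      ∑ b : {b : SubBasis g // b.IsOptimal w},
        countingSeries (fun x : {x // x ∈ Λ ∧ b.1.InHalfOpenCone q x} => ⌊∑ k, χ x k⌋₊) := by
    rw [← countingSeries_sigma
      (fun (b : {b : SubBasis g // b.IsOptimal w}) (x : {x // x ∈ Λ ∧ b.1.InHalfOpenCone q x}) =>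
        ⌊∑ k, χ x k⌋₊) fun b k => hfib b.1 k]
    exact (countingSeries_congr e fun p => rfl).symm
  have hbox : ∀ b : SubBasis g, (1 - PowerSeries.X) ^ Module.finrank ℝ W *
      countingSeries (fun x : {x // x ∈ Λ ∧ b.InHalfOpenCone q x} => ⌊∑ k, χ x k⌋₊) =
      countingSeries (fun x : {x // x ∈ Λ ∧ b.InBox q x} => ⌊∑ k, χ x k⌋₊) := by
    intro b
    have := finite_box hΛ b q
    rw [← one_sub_pow_mul_countingSeries_prod (S := {x // x ∈ Λ ∧ b.InBox q x}) b.carrier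
      fun k => inferInstance, Fintype.card_coe, b.card_carrier]
    congr 1
    refine (countingSeries_congr (b.boxEquiv q Λ hg) fun p => ?_).symm
    have hp : p.1.1 ∈ posCone g := ⟨b.coord p.1.1, fun i => by
      by_cases hi : i ∈ b.carrier
      · exact (p.1.2.2 i hi).1
      · rw [b.coord_of_notMem _ hi], b.sum_coord_smul _⟩
    have h1 := natCast_floor_degree hχ hint p.1.2.1 hp
    have h2 := natCast_floor_degree hχ hint (b.boxEquiv q Λ hg p).2.1
      (b.boxEquiv q Λ hg p).2.2.mem_posCone
    have h3 : ((b.boxEquiv q Λ hg p : {x // x ∈ Λ ∧ b.InHalfOpenCone q x}) : W) =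
      p.1.1 + ∑ i, p.2 i • g i := rfl
    have h4 : ∑ k, χ (p.1.1 + ∑ i, p.2 i • g i) k = ∑ k, χ p.1.1 k + ((∑ i, p.2 i : ℕ) : ℝ) := by
      simp only [map_add, map_sum, Pi.add_apply, Finset.sum_add_distrib, map_nsmul,
        Finset.sum_apply, Pi.smul_apply, hχ]
      congr 1
      rw [Finset.sum_comm]
      push_cast
      exact Finset.sum_congr rfl fun i _ => by rw [← Finset.smul_sum]; simp
    rw [h3] at h2
    rw [h3]
    have h5 := h2.trans (h4.trans (congrArg (· + ((∑ i, p.2 i : ℕ) : ℝ)) h1.symm))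
    exact_mod_cast h5
  have hpoly : ∀ b : {b : SubBasis g // b.IsOptimal w}, ∃ h : ℤ[X],
      h.natDegree ≤ Module.finrank ℝ W - Fintype.card κ ∧
      (h : ℤ⟦X⟧) = countingSeries (fun x : {x // x ∈ Λ ∧ b.1.InBox q x} => ⌊∑ k, χ x k⌋₊) := by
    intro b
    have := finite_box hΛ b.1 q
    refine exists_polynomial_eq_countingSeries _ fun x => ?_
    have h1 := x.2.2.degree_add_card_le hχ hint hqpos x.2.1
    have hx : x.1 ∈ posCone g := ⟨b.1.coord x.1, fun i => by
      by_cases hi : i ∈ b.1.carrier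
      · exact (x.2.2 i hi).1
      · rw [b.1.coord_of_notMem _ hi], b.1.sum_coord_smul _⟩
    rw [← natCast_floor_degree hχ hint x.2.1 hx] at h1
    exact Nat.le_sub_of_add_le (by exact_mod_cast h1)
  choose h hdeg hh using hpoly
  refine ⟨∑ b, h b, Polynomial.natDegree_sum_le_of_forall_le _ _ fun b _ => hdeg b, ?_⟩
  rw [hcone, Finset.mul_sum, ← Polynomial.coeToPowerSeries.ringHom_apply, map_sum]
  exact Finset.sum_congr rfl fun b _ => by
    rw [Polynomial.coeToPowerSeries.ringHom_apply, hh, hbox]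

end Cone

/-! ### Dimensions of Minkowski sums and of Cayley polytopes -/

section Dimension

variable {E : Type*} [AddCommGroup E] [Module ℝ E]

theorem vectorSpan_sum {κ : Type*} [Fintype κ] (Δ : κ → Set E) (h : ∀ i, (Δ i).Nonempty) :
    vectorSpan ℝ (∑ i, Δ i) = ⨆ i, vectorSpan ℝ (Δ i) := by
  classical
  apply le_antisymm
  · rw [vectorSpan_def, Submodule.span_le]
    rintro _ ⟨x, hx, y, hy, rfl⟩
    obtain ⟨f, hf, rfl⟩ := (Set.mem_fintype_sum _ _).1 hx
    obtain ⟨f', hf', rfl⟩ := (Set.mem_fintype_sum _ _).1 hy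
    simp only [vsub_eq_sub, ← Finset.sum_sub_distrib]
    exact Submodule.sum_mem _ fun i _ =>
      Submodule.mem_iSup_of_mem i (vsub_mem_vectorSpan ℝ (hf i) (hf' i))
  · refine iSup_le fun i => ?_
    rw [vectorSpan_def, Submodule.span_le]
    rintro _ ⟨x, hx, y, hy, rfl⟩
    choose p hp using h
    have hmem : ∀ z ∈ Δ i, (∑ j, Function.update p i z j) ∈ ∑ j, Δ j := fun z hz =>
      (Set.mem_fintype_sum _ _).2 ⟨Function.update p i z, fun j => by
        by_cases hj : j = i
        · subst hj; simpa using hz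
        · simpa [hj] using hp j, rfl⟩
    have hsub : ∑ j, Function.update p i x j - ∑ j, Function.update p i y j = x - y := by
      rw [← Finset.sum_sub_distrib, Fintype.sum_eq_single i fun j hj => by simp [hj]]
      simp
    have := vsub_mem_vectorSpan ℝ (hmem x hx) (hmem y hy)
    rwa [vsub_eq_sub, hsub] at this

/-- The shear `(z, c) ↦ (z - ∑ c_i p_i, c)` maps the span of `S` onto `N × ℝ^κ`. -/
theorem finrank_span_eq_add_card [FiniteDimensional ℝ E] {κ : Type*} [Fintype κ] [DecidableEq κ]
    (N : Submodule ℝ E)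
    (p : κ → E) (S : Set (E × (κ → ℝ))) (hS : ∀ x ∈ S, x.1 - ∑ i, x.2 i • p i ∈ N)
    (hp : ∀ i, (p i, Pi.single i 1) ∈ Submodule.span ℝ S)
    (hN : ∀ n ∈ N, (n, 0) ∈ Submodule.span ℝ S) :
    Module.finrank ℝ (Submodule.span ℝ S) = Module.finrank ℝ N + Fintype.card κ := by
  let f : (κ → ℝ) →ₗ[ℝ] E := Fintype.linearCombination ℝ p
  have hf : ∀ c, f c = ∑ i, c i • p i := fun c => Fintype.linearCombination_apply ℝ p c
  let e : (N × (κ → ℝ)) →ₗ[ℝ] E × (κ → ℝ) :=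
    LinearMap.prod (N.subtype.comp (LinearMap.fst ℝ _ _) + f.comp (LinearMap.snd ℝ _ _))
      (LinearMap.snd ℝ _ _)
  have he : ∀ n c, e (n, c) = (n + ∑ i, c i • p i, c) := fun n c => by simp [e, hf]
  have hinj : Function.Injective e := by
    rintro ⟨n, c⟩ ⟨n', c'⟩ h
    rw [he, he, Prod.mk.injEq] at h
    obtain ⟨h1, rfl⟩ := h
    rw [Subtype.ext (add_right_cancel h1)]
  have hrange : LinearMap.range e = Submodule.span ℝ S := by
    apply le_antisymm
    · rintro _ ⟨⟨n, c⟩, rfl⟩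
      have : e (n, c) = ((n : E), 0) + ∑ i, c i • (p i, (Pi.single i 1 : κ → ℝ)) := by
        rw [he]
        refine Prod.ext ?_ ?_
        · simp [Prod.fst_sum]
        · simp only [Prod.snd_add, Prod.snd_sum, Prod.smul_snd, zero_add]
          exact pi_eq_sum_univ' c |>.trans (Finset.sum_congr rfl fun i _ => by
            congr 1)
      rw [this]
      exact Submodule.add_mem _ (hN n n.2)
        (Submodule.sum_mem _ fun i _ => Submodule.smul_mem _ _ (hp i))
    · rw [Submodule.span_le]
      rintro x hx
      exact ⟨(⟨_, hS x hx⟩, x.2), by rw [he]; simp⟩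
  rw [← hrange, LinearMap.finrank_range_of_inj hinj, Module.finrank_prod, Module.finrank_pi]

theorem polytopeDim_cayleyPolytope [FiniteDimensional ℝ E] {r : ℕ} (Δ : Fin (r + 1) → Set E)
    (h : ∀ i, (Δ i).Nonempty) :
    polytopeDim (cayleyPolytope Δ) = polytopeDim (∑ i, Δ i) + r := by
  rw [polytopeDim, polytopeDim, cayleyPolytope, ← direction_affineSpan, affineSpan_convexHull,
    direction_affineSpan, vectorSpan_sum Δ h]
  choose p hp using h
  have hmem : ∀ i, ∀ v ∈ Δ i, (v, simplexVertex r i) ∈ ⋃ i, Δ i ×ˢ {simplexVertex r i} :=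
    fun i v hv => Set.mem_iUnion.2 ⟨i, hv, rfl⟩
  rw [vectorSpan_eq_span_vsub_set_right ℝ (hmem 0 (p 0) (hp 0))]
  have hsub : ∀ i, ∀ v ∈ Δ i, (v - p 0, simplexVertex r i) ∈ Submodule.span ℝ
      ((fun x => x -ᵥ (p 0, simplexVertex r 0)) '' ⋃ i, Δ i ×ˢ {simplexVertex r i}) :=
    fun i v hv => Submodule.subset_span ⟨_, hmem i v hv, by simp [simplexVertex]⟩
  have hdiff : ∀ i, ∀ v ∈ Δ i, v - p i ∈ ⨆ i, vectorSpan ℝ (Δ i) := fun i v hv =>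
    Submodule.mem_iSup_of_mem i (vsub_mem_vectorSpan ℝ hv (hp i))
  refine (finrank_span_eq_add_card (⨆ i, vectorSpan ℝ (Δ i)) (fun i : Fin r => p i.succ - p 0) _
    ?_ ?_ ?_).trans (by rw [Fintype.card_fin])
  · rintro _ ⟨⟨v, c⟩, hx, rfl⟩
    obtain ⟨i, hv, hc⟩ := Set.mem_iUnion.1 hx
    have hc : c = simplexVertex r i := hc
    subst hc
    refine Fin.cases (fun hv => ?_) (fun i hv => ?_) i hv
    · simpa [simplexVertex] using hdiff 0 v hv
    · have : ∑ j, (Pi.single i 1 : Fin r → ℝ) j • (p j.succ - p 0) = p i.succ - p 0 := by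
        rw [Fintype.sum_eq_single i fun j hj => by rw [Pi.single_eq_of_ne hj, zero_smul]]
        simp
      simpa [simplexVertex, this] using hdiff i.succ v hv
  · intro i
    simpa [simplexVertex] using hsub i.succ _ (hp i.succ)
  · intro n hn
    suffices H : ⨆ i, vectorSpan ℝ (Δ i) ≤ (Submodule.span ℝ
      ((fun x => x -ᵥ (p 0, simplexVertex r 0)) '' ⋃ i, Δ i ×ˢ {simplexVertex r i})).comap
        (LinearMap.inl ℝ E (Fin r → ℝ)) from H hn
    refine iSup_le fun i => ?_
    rw [vectorSpan_def, Submodule.span_le]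
    rintro _ ⟨x, hx, y, hy, rfl⟩
    simpa using Submodule.sub_mem _ (hsub i x hx) (hsub i y hy)

end Dimension

/-! ### The cone over a Cayley polytope -/

/-- The dilate of a convex hull, described by nonnegative coefficients of fixed sum. -/
theorem mem_smul_convexHull_range {F ι : Type*} [AddCommGroup F] [Module ℝ F] [Fintype ι]
    [Nonempty ι] (p : ι → F) {t : ℝ} (ht : 0 ≤ t) {x : F} :
    x ∈ t • convexHull ℝ (Set.range p) ↔
      ∃ l : ι → ℝ, (∀ i, 0 ≤ l i) ∧ ∑ i, l i = t ∧ ∑ i, l i • p i = x := by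
  classical
  have hhull : convexHull ℝ (Set.range p) = Fintype.linearCombination ℝ p '' stdSimplex ℝ ι := by
    rw [← convexHull_basis_eq_stdSimplex, LinearMap.image_convexHull, ← Set.range_comp]
    congr 2
    funext i
    simp [Fintype.linearCombination_apply]
  rw [hhull]
  constructor
  · rintro ⟨_, ⟨l, ⟨hl0, hl1⟩, rfl⟩, rfl⟩
    refine ⟨fun i => t * l i, fun i => mul_nonneg ht (hl0 i), ?_, ?_⟩
    · rw [← Finset.mul_sum, hl1, mul_one]
    · simp [Fintype.linearCombination_apply, Finset.smul_sum, mul_smul]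
  · rintro ⟨l, hl0, hl1, rfl⟩
    rcases ht.eq_or_lt with h | h
    · -- All coefficients vanish, and any point of the hull is dilated to the origin.
      have hl : ∀ i, l i = 0 := fun i =>
        (Finset.sum_eq_zero_iff_of_nonneg fun i _ => hl0 i).1 (hl1.trans h.symm) i
          (Finset.mem_univ i)
      refine ⟨_, ⟨_, single_mem_stdSimplex ℝ (Classical.arbitrary ι), rfl⟩, ?_⟩
      simp [← h, hl]
    · refine ⟨_, ⟨fun i => t⁻¹ * l i, ⟨fun i => mul_nonneg (inv_nonneg.2 ht) (hl0 i), ?_⟩, rfl⟩, ?_⟩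
      · rw [← Finset.mul_sum, hl1, inv_mul_cancel₀ h.ne']
      · simp [Fintype.linearCombination_apply, Finset.smul_sum, smul_smul, ← mul_assoc,
          mul_inv_cancel₀ h.ne']

theorem mem_intLattice {r : ℕ} {c : Fin r → ℝ} : c ∈ intLattice r ↔ ∀ i, ∃ n : ℤ, c i = n := by
  rw [intLattice, Module.Basis.mem_span_iff_repr_mem]
  simp [Set.mem_range, eq_comm]

section Cayley

variable {E : Type*} [AddCommGroup E] [Module ℝ E] {r : ℕ}

/-- The generators `(v, e_i)`, for `v` in `V i`, of the cone over the Cayley polytope of the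
convex hulls of the `V i`. The lattice `ℤ ^ r` and its vertices `e_0 = 0, e_1, …, e_r` are
replaced by `ℤ ^ (r + 1)` and its basis, so that heights are sums of coordinates. -/
def cayleyGenerator (V : Fin (r + 1) → Finset E) (j : Σ i, V i) : E × (Fin (r + 1) → ℝ) :=
  (j.2, Pi.single j.1 1)

theorem mem_posCone_cayleyGenerator {V : Fin (r + 1) → Finset E} (hV : ∀ i, (V i).Nonempty)
    {z : E} {c : Fin (r + 1) → ℝ} :
    (z, c) ∈ posCone (cayleyGenerator V) ↔ (∀ i, 0 ≤ c i) ∧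
      ∃ y : Fin (r + 1) → E, (∀ i, y i ∈ c i • convexHull ℝ (V i : Set E)) ∧ ∑ i, y i = z := by
  have hne : ∀ i, Nonempty (V i) := fun i => (hV i).to_subtype
  have hhull : ∀ i, (V i : Set E) = Set.range (fun v : V i => (v : E)) := fun i => by simp
  have hsum : ∀ l : (Σ i, V i) → ℝ, ∑ j, l j • cayleyGenerator V j =
      (∑ i, ∑ v : V i, l ⟨i, v⟩ • (v : E), fun i => ∑ v : V i, l ⟨i, v⟩) := by
    intro l
    rw [Fintype.sum_sigma]
    refine Prod.ext ?_ ?_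
    · simp [Prod.fst_sum, cayleyGenerator]
    · funext k
      simp only [Prod.snd_sum, cayleyGenerator, Prod.smul_snd, Finset.sum_apply, Pi.smul_apply,
        Pi.single_apply, smul_eq_mul, mul_ite, mul_one, mul_zero]
      rw [Fintype.sum_eq_single k fun i hi => by simp [hi.symm]]
      simp
  constructor
  · rintro ⟨l, hl, h⟩
    rw [hsum, Prod.mk.injEq] at h
    obtain ⟨rfl, rfl⟩ := h
    have hnn : ∀ i, 0 ≤ ∑ v : V i, l ⟨i, v⟩ := fun i => Finset.sum_nonneg fun v _ => hl _
    refine ⟨hnn, _, fun i => ?_, rfl⟩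
    rw [hhull, mem_smul_convexHull_range _ (hnn i)]
    exact ⟨fun v => l ⟨i, v⟩, fun v => hl _, rfl, rfl⟩
  · rintro ⟨hc, y, hy, rfl⟩
    have h := fun i => (mem_smul_convexHull_range (fun v : V i => (v : E)) (hc i)).1
      (by rw [← hhull]; exact hy i)
    choose l hl0 hl1 hl2 using h
    refine ⟨fun j => l j.1 j.2, fun j => hl0 _ _, ?_⟩
    rw [hsum]
    simp only [hl1, hl2]

theorem cayleyPolytope_eq_convexHull_range (V : Fin (r + 1) → Finset E) :
    cayleyPolytope (fun i => convexHull ℝ (V i : Set E)) =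
      convexHull ℝ (Set.range fun j : Σ i, V i => ((j.2 : E), simplexVertex r j.1)) := by
  apply Set.Subset.antisymm
  · refine convexHull_min (Set.iUnion_subset fun i => ?_) (convex_convexHull ℝ _)
    rw [← convexHull_singleton (𝕜 := ℝ) (simplexVertex r i), ← convexHull_prod]
    refine convexHull_mono ?_
    rintro ⟨v, c⟩ ⟨hv, hc⟩
    have hc : c = simplexVertex r i := hc
    exact ⟨⟨i, v, hv⟩, by rw [hc]⟩
  · refine convexHull_mono ?_
    rintro _ ⟨⟨i, v⟩, rfl⟩
    exact Set.mem_iUnion.2 ⟨i, subset_convexHull ℝ _ v.2, rfl⟩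

/-- Forgetting the coordinate of `e_0` identifies the points of height `k` of the cone with the
points of the `k`-th dilate of the Cayley polytope. -/
theorem mem_smul_cayleyPolytope {V : Fin (r + 1) → Finset E} (hV : ∀ i, (V i).Nonempty)
    (k : ℕ) {z : E} {c : Fin r → ℝ} :
    (z, c) ∈ (k : ℝ) • cayleyPolytope (fun i => convexHull ℝ (V i : Set E)) ↔
      (z, (Fin.cons (k - ∑ i, c i) c : Fin (r + 1) → ℝ)) ∈ posCone (cayleyGenerator V) := by
  have hne : Nonempty (Σ i, V i) := ⟨⟨0, _, (hV 0).choose_spec⟩⟩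
  rw [cayleyPolytope_eq_convexHull_range, mem_smul_convexHull_range _ (Nat.cast_nonneg k)]
  have hfst : ∀ l : (Σ i, V i) → ℝ, (∑ j, l j • cayleyGenerator V j).1 =
      (∑ j, l j • ((j.2 : E), simplexVertex r j.1)).1 := fun l => by
    simp [Prod.fst_sum, cayleyGenerator]
  have hsnd : ∀ (l : (Σ i, V i) → ℝ) (i : Fin r), (∑ j, l j • cayleyGenerator V j).2 i.succ =
      (∑ j, l j • ((j.2 : E), simplexVertex r j.1)).2 i := fun l i => by
    simp only [Prod.snd_sum, cayleyGenerator, Prod.smul_snd, Finset.sum_apply, Pi.smul_apply]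
    refine Finset.sum_congr rfl fun j _ => ?_
    obtain ⟨a, v⟩ := j
    rcases Fin.eq_zero_or_eq_succ a with rfl | ⟨a, rfl⟩ <;>
      simp [simplexVertex, Pi.single_apply]
  have hdeg : ∀ l : (Σ i, V i) → ℝ, ∑ i, (∑ j, l j • cayleyGenerator V j).2 i = ∑ j, l j :=
    fun l => sum_map_sum_smul (χ := LinearMap.snd ℝ E (Fin (r + 1) → ℝ)) (g := cayleyGenerator V)
      (color := Sigma.fst) (fun _ => rfl) l
  refine exists_congr fun l => and_congr_right fun _ => ?_
  constructor
  · rintro ⟨h1, h2⟩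
    refine Prod.ext (by rw [hfst, h2]) (funext fun i => ?_)
    have hsucc : ∀ i : Fin r, (∑ j, l j • cayleyGenerator V j).2 i.succ = c i := fun i => by
      rw [hsnd, h2]
    refine Fin.cases ?_ (fun i => by simpa using hsucc i) i
    have h3 := hdeg l
    rw [Fin.sum_univ_succ, h1] at h3
    simp only [hsucc] at h3
    simp only [Fin.cons_zero]
    linarith
  · intro h
    constructor
    · rw [← hdeg, h]
      simp [Fin.sum_univ_succ]
    · refine Prod.ext (by rw [← hfst, h]) (funext fun i => ?_)
      rw [← hsnd, h]
      simp

theorem floor_eq_iff_of_mem_posCone {L : Submodule ℤ E} {V : Fin (r + 1) → Finset E}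
    {x : E × (Fin (r + 1) → ℝ)} (hx : x ∈ L.prod (intLattice (r + 1)))
    (hxc : x ∈ posCone (cayleyGenerator V)) (k : ℕ) : ⌊∑ i, x.2 i⌋₊ = k ↔ ∑ i, x.2 i = k := by
  have h := natCast_floor_degree (χ := LinearMap.snd ℝ E (Fin (r + 1) → ℝ))
    (g := cayleyGenerator V) (color := Sigma.fst) (fun _ => rfl)
    (Λ := L.prod (intLattice (r + 1))) (fun y hy => mem_intLattice.1 hy.2) hx hxc
  simp only [LinearMap.snd_apply] at h
  rw [← h, Nat.floor_natCast, Nat.cast_inj]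

theorem ehrhartSeries_cayleyPolytope (L : Submodule ℤ E) {V : Fin (r + 1) → Finset E}
    (hV : ∀ i, (V i).Nonempty) :
    ehrhartSeries (L.prod (intLattice r)) (cayleyPolytope fun i => convexHull ℝ (V i : Set E)) =
      countingSeries (fun x : {x // x ∈ L.prod (intLattice (r + 1)) ∧
        x ∈ posCone (cayleyGenerator V)} => ⌊∑ i, x.1.2 i⌋₊) := by
  ext k
  simp only [ehrhartSeries, countingSeries, PowerSeries.coeff_mk]
  rw [← Nat.card_coe_set_eq]
  congr 1
  refine Nat.card_congr (Equiv.ofBijective (fun x =>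
    ⟨⟨(x.1.1, Fin.cons (k - ∑ i, x.1.2 i) x.1.2), ⟨x.2.2.1, ?_⟩,
      (mem_smul_cayleyPolytope hV k).1 x.2.1⟩, ?_⟩) ⟨?_, ?_⟩)
  · have hx := mem_intLattice.1 x.2.2.2
    refine mem_intLattice.2 fun i => Fin.cases ?_ (fun i => by simpa using hx i) i
    choose n hn using hx
    exact ⟨k - ∑ i, n i, by simp [hn]⟩
  · refine (floor_eq_iff_of_mem_posCone ⟨x.2.2.1, ?_⟩ ((mem_smul_cayleyPolytope hV k).1 x.2.1)
      k).2 (by simp [Fin.sum_univ_succ])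
    have hx := mem_intLattice.1 x.2.2.2
    refine mem_intLattice.2 fun i => Fin.cases ?_ (fun i => by simpa using hx i) i
    choose n hn using hx
    exact ⟨k - ∑ i, n i, by simp [hn]⟩
  · intro x y h
    simp only [Subtype.mk.injEq, Prod.mk.injEq, Fin.cons_inj] at h
    exact Subtype.ext (Prod.ext h.1 h.2.2)
  · rintro ⟨⟨⟨z, c⟩, hx, hxc⟩, hk⟩
    rw [floor_eq_iff_of_mem_posCone hx hxc] at hk
    have hc : (Fin.cons (k - ∑ i, Fin.tail c i) (Fin.tail c) : Fin (r + 1) → ℝ) = c := by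
      conv_rhs => rw [← Fin.cons_self_tail c]
      congr 1
      rw [← hk, Fin.sum_univ_succ]
      simp [Fin.tail]
    refine ⟨⟨(z, Fin.tail c), (mem_smul_cayleyPolytope hV k).2 (by rw [hc]; exact hxc), hx.1,
      mem_intLattice.2 fun i => mem_intLattice.1 hx.2 i.succ⟩, ?_⟩
    simp only [hc]

theorem finrank_span_cayleyGenerator [FiniteDimensional ℝ E]
    {V : Fin (r + 1) → Finset E} (hV : ∀ i, (V i).Nonempty) :
    Module.finrank ℝ (Submodule.span ℝ (Set.range (cayleyGenerator V))) =
      polytopeDim (∑ i, convexHull ℝ (V i : Set E)) + (r + 1) := by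
  rw [polytopeDim, vectorSpan_sum _ fun i => (Finset.coe_nonempty.2 (hV i)).convexHull]
  choose p hp using hV
  have hmem : ∀ i, ∀ v ∈ V i, (v, Pi.single i 1) ∈
      Submodule.span ℝ (Set.range (cayleyGenerator V)) :=
    fun i v hv => Submodule.subset_span ⟨⟨i, v, hv⟩, rfl⟩
  refine (finrank_span_eq_add_card (⨆ i, vectorSpan ℝ (convexHull ℝ (V i : Set E))) p _
    ?_ (fun i => hmem i _ (hp i)) ?_).trans (by rw [Fintype.card_fin])
  · rintro _ ⟨⟨i, v⟩, rfl⟩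
    simp only [cayleyGenerator]
    rw [Fintype.sum_eq_single i fun j hj => by rw [Pi.single_eq_of_ne hj, zero_smul],
      Pi.single_eq_same, one_smul]
    exact Submodule.mem_iSup_of_mem i (vsub_mem_vectorSpan ℝ
      (subset_convexHull ℝ _ v.2) (subset_convexHull ℝ _ (hp i)))
  · intro n hn
    suffices H : ⨆ i, vectorSpan ℝ (convexHull ℝ (V i : Set E)) ≤
      (Submodule.span ℝ (Set.range (cayleyGenerator V))).comap
        (LinearMap.inl ℝ E (Fin (r + 1) → ℝ)) from H hn
    refine iSup_le fun i => ?_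
    rw [← direction_affineSpan, affineSpan_convexHull, direction_affineSpan, vectorSpan_def,
      Submodule.span_le]
    rintro _ ⟨x, hx, y, hy, rfl⟩
    simpa using Submodule.sub_mem _ (hmem i x hx) (hmem i y hy)

end Cayley

/-! ### The degree bound -/

section Bound

variable {E : Type*} [NormedAddCommGroup E] [NormedSpace ℝ E] {r : ℕ}

theorem finite_inter_lattice_of_isBounded [FiniteDimensional ℝ E] (L : Submodule ℤ E)
    [DiscreteTopology L] {s : Set E} (hs : Bornology.IsBounded s) : (s ∩ L).Finite := by
  have : ProperSpace E := FiniteDimensional.proper ℝ E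
  have : DiscreteTopology L.toAddSubgroup := inferInstanceAs (DiscreteTopology L)
  refine Metric.finite_isBounded_inter_isClosed DiscreteTopology.isDiscrete hs ?_
  rw [← Submodule.coe_toAddSubgroup]
  exact AddSubgroup.isClosed_of_discrete

theorem finite_inter_prod_intLattice_of_isBounded [FiniteDimensional ℝ E] (L : Submodule ℤ E)
    [DiscreteTopology L] {n : ℕ} {s : Set (E × (Fin n → ℝ))} (hs : Bornology.IsBounded s) :
    (s ∩ L.prod (intLattice n)).Finite := by
  refine ((finite_inter_lattice_of_isBounded L hs.image_fst).prod
    (ZSpan.setFinite_inter (Pi.basisFun ℝ (Fin n)) hs.image_snd)).subset ?_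
  rintro x ⟨hx, hxL⟩
  exact ⟨⟨⟨x, hx, rfl⟩, hxL.1⟩, ⟨⟨x, hx, rfl⟩, hxL.2⟩⟩

theorem latticeDegree_cayleyPolytope_le [FiniteDimensional ℝ E] (L : Submodule ℤ E)
    [DiscreteTopology L] {V : Fin (r + 1) → Finset E} (hV : ∀ i, (V i).Nonempty)
    (hVL : ∀ i, (V i : Set E) ⊆ L) :
    latticeDegree (L.prod (intLattice r)) (cayleyPolytope fun i => convexHull ℝ (V i : Set E)) ≤
      (polytopeDim (∑ i, convexHull ℝ (V i : Set E)) : ℕ∞) := by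
  set Λ := L.prod (intLattice (r + 1)) with hΛdef
  set U := Submodule.span ℝ (Set.range (cayleyGenerator V)) with hU
  -- The generators need not span the ambient space: restrict everything to their span.
  let g : (Σ i, V i) → U := fun j => ⟨cayleyGenerator V j, Submodule.subset_span ⟨j, rfl⟩⟩
  let Λ' : Submodule ℤ U := Λ.comap (U.subtype.restrictScalars ℤ)
  let χ : U →ₗ[ℝ] Fin (r + 1) → ℝ := (LinearMap.snd ℝ E (Fin (r + 1) → ℝ)).comp U.subtype
  have hg : ∀ j, g j ∈ Λ' := fun j => by
    refine ⟨hVL j.1 j.2.2, mem_intLattice.2 fun i => ?_⟩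
    by_cases h : i = j.1
    · subst h; exact ⟨1, by simp [g, cayleyGenerator]⟩
    · exact ⟨0, by simp [g, cayleyGenerator, h]⟩
  have hΛ' : ∀ s : Set U, Bornology.IsBounded s → (s ∩ Λ').Finite := by
    intro s hs
    have hb : Bornology.IsBounded ((fun x : U => (x : E × (Fin (r + 1) → ℝ))) '' s) := by
      obtain ⟨C, hC⟩ := isBounded_iff_forall_norm_le.1 hs
      refine isBounded_iff_forall_norm_le.2 ⟨C, ?_⟩
      rintro _ ⟨x, hx, rfl⟩
      exact hC x hx
    refine Set.Finite.of_finite_image (f := fun x : U => (x : E × (Fin (r + 1) → ℝ)))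
      ((finite_inter_prod_intLattice_of_isBounded L hb).subset ?_)
      Subtype.val_injective.injOn
    rintro _ ⟨x, ⟨hx, hxΛ⟩, rfl⟩
    exact ⟨⟨x, hx, rfl⟩, hxΛ⟩
  have hspan : Submodule.span ℝ (Set.range g) = ⊤ := by
    refine Submodule.map_injective_of_injective U.injective_subtype ?_
    rw [Submodule.map_span, ← Set.range_comp, Submodule.map_top, Submodule.range_subtype]
    rfl
  have hcone : ∀ x : U, x ∈ posCone g ↔ (x : E × (Fin (r + 1) → ℝ)) ∈
      posCone (cayleyGenerator V) := fun x => by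
    refine exists_congr fun l => and_congr_right fun _ => ?_
    rw [← Subtype.val_inj]
    simp [g]
  have hsub : ∀ x ∈ posCone (cayleyGenerator V), x ∈ U := by
    rintro _ ⟨l, -, rfl⟩
    exact Submodule.sum_mem _ fun j _ => Submodule.smul_mem _ _ (Submodule.subset_span ⟨j, rfl⟩)
  obtain ⟨h, hdeg, hh⟩ := exists_polynomial_eq_coneSeries (color := Sigma.fst) (χ := χ) hΛ' hg
    hspan (fun i => ⟨⟨i, _, (hV i).choose_spec⟩, rfl⟩) (fun _ => rfl)
    (fun x hx => mem_intLattice.1 hx.2)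
  rw [finrank_span_cayleyGenerator hV, Fintype.card_fin, Nat.add_sub_cancel] at hdeg
  refine (iInf₂_le h ?_).trans (by exact_mod_cast hdeg)
  rw [hh, hStarSeries, polytopeDim_cayleyPolytope _ fun i =>
    (Finset.coe_nonempty.2 (hV i)).convexHull, ehrhartSeries_cayleyPolytope L hV,
    finrank_span_cayleyGenerator hV, add_assoc]
  congr 1
  let e : {x // x ∈ Λ' ∧ x ∈ posCone g} ≃ {x // x ∈ Λ ∧ x ∈ posCone (cayleyGenerator V)} :=
    { toFun := fun x => ⟨x.1, x.2.1, (hcone _).1 x.2.2⟩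
      invFun := fun x => ⟨⟨x.1, hsub _ x.2.2⟩, x.2.1, (hcone _).2 x.2.2⟩
      left_inv := fun x => rfl
      right_inv := fun x => rfl }
  exact countingSeries_congr e fun x => rfl

end Bound

/-! ### Pyramids -/

section Pyramid

variable {E : Type*} [AddCommGroup E] [Module ℝ E]

theorem ehrhartSeries_eq_countingSeries (L : Submodule ℤ E) (Δ : Set E) :
    ehrhartSeries L Δ =
      countingSeries (fun p : {p : ℕ × E // p.2 ∈ ((p.1 : ℝ) • Δ) ∩ (L : Set E)} => p.1.1) := by
  ext k
  simp only [ehrhartSeries, countingSeries, PowerSeries.coeff_mk]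
  rw [← Nat.card_coe_set_eq]
  congr 1
  refine Nat.card_congr
    { toFun := fun x => ⟨⟨(k, x.1), x.2⟩, rfl⟩
      invFun := fun p => ⟨p.1.1.2, by simpa only [p.2] using p.1.2⟩
      left_inv := fun x => rfl
      right_inv := ?_ }
  rintro ⟨⟨⟨m, x⟩, hx⟩, hm⟩
  simp only at hm
  subst hm
  rfl

theorem eq_singleton_of_polytopeDim_eq_zero [FiniteDimensional ℝ E] {Δ : Set E} {p : E}
    (hp : p ∈ Δ) (h : polytopeDim Δ = 0) : Δ = {p} := by
  refine Set.eq_singleton_iff_unique_mem.2 ⟨hp, fun x hx => ?_⟩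
  have := vsub_mem_vectorSpan ℝ hx hp
  rwa [Submodule.finrank_eq_zero.1 h, Submodule.mem_bot, vsub_eq_sub, sub_eq_zero] at this

theorem polytopeDim_sum_of_isPyramidFamily [FiniteDimensional ℝ E] {r : ℕ}
    {Δ : Fin (r + 1) → Set E} (hne : ∀ i, (Δ i).Nonempty) (h : IsPyramidFamily Δ) :
    polytopeDim (∑ i, Δ i) = polytopeDim (Δ 0) := by
  rw [polytopeDim, polytopeDim, vectorSpan_sum Δ hne]
  have : ⨆ i, vectorSpan ℝ (Δ i) = vectorSpan ℝ (Δ 0) := by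
    refine le_antisymm (iSup_le fun i => Fin.cases le_rfl (fun i => ?_) i)
      (le_iSup (fun i => vectorSpan ℝ (Δ i)) 0)
    rw [Submodule.finrank_eq_zero.1 (h i)]
    exact bot_le
  rw [this]

/-- A lattice point of the cone over an `r`-fold pyramid is a lattice point of a dilate of the base
together with the multiplicities, which are free, of the `r` apices. -/
theorem one_sub_pow_mul_ehrhartSeries_cayleyPolytope (L : Submodule ℤ E) {r : ℕ}
    {V : Fin (r + 1) → Finset E} (hV : ∀ i, (V i).Nonempty) {p : Fin r → E} (hpL : ∀ i, p i ∈ L)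
    (hp : ∀ i, convexHull ℝ (V i.succ : Set E) = {p i})
    (hfin : ∀ k : ℕ, (((k : ℝ) • convexHull ℝ (V 0 : Set E)) ∩ (L : Set E)).Finite) :
    (1 - PowerSeries.X) ^ r * ehrhartSeries (L.prod (intLattice r))
      (cayleyPolytope fun i => convexHull ℝ (V i : Set E)) =
      ehrhartSeries L (convexHull ℝ (V 0 : Set E)) := by
  rw [ehrhartSeries_cayleyPolytope L hV, ehrhartSeries_eq_countingSeries L]
  set S := {p : ℕ × E // p.2 ∈ ((p.1 : ℝ) • convexHull ℝ (V 0 : Set E)) ∩ (L : Set E)}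
  have hSfin : ∀ k, Finite {s : S // s.1.1 = k} := by
    intro k
    have := (hfin k).to_subtype
    refine Finite.of_injective (β := ↥(((k : ℝ) • convexHull ℝ (V 0 : Set E)) ∩ (L : Set E)))
      (fun s => ⟨s.1.1.2, by simpa only [s.2] using s.1.2⟩) ?_
    rintro ⟨s, hs⟩ ⟨t, ht⟩ h
    exact Subtype.ext (Subtype.ext (Prod.ext (hs.trans ht.symm) (Subtype.mk.inj h)))
  have key := one_sub_pow_mul_countingSeries_prod (d := fun s : S => s.1.1) (Fin r) hSfin
  rw [Fintype.card_fin] at key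
  rw [← key]
  congr 1
  have hcone : ∀ (s : S) (n : Fin r → ℕ),
      (s.1.2 + ∑ i, n i • p i, (Fin.cons (s.1.1 : ℝ) fun i => (n i : ℝ) : Fin (r + 1) → ℝ)) ∈
        posCone (cayleyGenerator V) := by
    intro s n
    refine (mem_posCone_cayleyGenerator hV).2 ⟨fun i => Fin.cases ?_ (fun i => ?_) i,
      Fin.cons s.1.2 fun i => n i • p i, fun i => Fin.cases ?_ (fun i => ?_) i, ?_⟩
    · simp
    · simp
    · simp [Fin.sum_univ_succ]
    · simpa using s.2.1
    · simp [hp, Nat.cast_smul_eq_nsmul]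
  have hlat : ∀ (s : S) (n : Fin r → ℕ),
      (s.1.2 + ∑ i, n i • p i, (Fin.cons (s.1.1 : ℝ) fun i => (n i : ℝ) : Fin (r + 1) → ℝ)) ∈
        L.prod (intLattice (r + 1)) := by
    intro s n
    refine ⟨L.add_mem s.2.2 (L.sum_mem fun i _ => L.smul_of_tower_mem (n i) (hpL i)),
      mem_intLattice.2 fun i => Fin.cases ⟨s.1.1, by simp⟩ (fun i => ⟨n i, by simp⟩) i⟩
  refine (countingSeries_congr (Equiv.ofBijective
    (fun q : S × (Fin r → ℕ) => ⟨_, hlat q.1 q.2, hcone q.1 q.2⟩) ⟨?_, ?_⟩) ?_).symm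
  · rintro ⟨⟨⟨k, x⟩, hx⟩, n⟩ ⟨⟨⟨k', x'⟩, hx'⟩, n'⟩ h
    simp only [Subtype.mk.injEq, Prod.mk.injEq, Fin.cons_inj, Nat.cast_inj] at h
    obtain ⟨h1, rfl, h2⟩ := h
    have hn : n = n' := funext fun i => by exact_mod_cast congrFun h2 i
    subst hn
    have := add_right_cancel h1
    subst this
    rfl
  · rintro ⟨⟨z, c⟩, hx, hxc⟩
    obtain ⟨hc, y, hy, hsum⟩ := (mem_posCone_cayleyGenerator hV).1 hxc
    have hnat : ∀ i, ∃ n : ℕ, c i = n := by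
      intro i
      obtain ⟨n, hn⟩ := mem_intLattice.1 hx.2 i
      have hn : c i = n := hn
      have h0 := hc i
      rw [hn] at h0
      obtain ⟨m, rfl⟩ := Int.eq_ofNat_of_zero_le (show 0 ≤ n by exact_mod_cast h0)
      exact ⟨m, by simpa using hn⟩
    choose n hn using hnat
    have hysucc : ∀ i : Fin r, y i.succ = n i.succ • p i := by
      intro i
      have := hy i.succ
      rw [hp, hn, Set.smul_set_singleton, Set.mem_singleton_iff, Nat.cast_smul_eq_nsmul] at this
      exact this
    have hz : y 0 + ∑ i : Fin r, n i.succ • p i = z := by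
      rw [← hsum, Fin.sum_univ_succ]
      simp only [hysucc]
    have hy0 : y 0 ∈ L := by
      rw [← add_sub_cancel_right (y 0) (∑ i : Fin r, n i.succ • p i), hz]
      exact L.sub_mem hx.1 (L.sum_mem fun i _ => L.smul_of_tower_mem _ (hpL i))
    refine ⟨(⟨(n 0, y 0), by rw [← hn]; exact hy 0, hy0⟩, fun i => n i.succ), ?_⟩
    refine Subtype.ext (Prod.ext hz (funext fun i => Fin.cases ?_ (fun i => ?_) i))
    · simp [hn]
    · simp [hn]
  · rintro ⟨s, n⟩
    refine (floor_eq_iff_of_mem_posCone (hlat s n) (hcone s n) _).2 ?_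
    simp [Fin.sum_univ_succ]

end Pyramid

theorem mainTheorem5 {E : Type*} [NormedAddCommGroup E] [NormedSpace ℝ E]
    [FiniteDimensional ℝ E] (L : Submodule ℤ E) [DiscreteTopology L] [IsZLattice ℝ L]
    (r : ℕ) (Δ : Fin (r + 1) → Set E) (hΔ : ∀ i, IsLatticePolytope L (Δ i)) :
    latticeDegree (L.prod (intLattice r)) (cayleyPolytope Δ) ≤ (polytopeDim (∑ i, Δ i) : ℕ∞) ∧
    polytopeDim (∑ i, Δ i) ≤ Module.finrank ℝ E ∧
    (IsPyramidFamily Δ →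
      latticeDegree (L.prod (intLattice r)) (cayleyPolytope Δ) = latticeDegree L (Δ 0)) := by
  choose V hV hVL hΔV using hΔ
  obtain rfl : Δ = fun i => convexHull ℝ (V i : Set E) := funext hΔV
  refine ⟨latticeDegree_cayleyPolytope_le L hV hVL, Submodule.finrank_le _, fun hpyr => ?_⟩
  have hne : ∀ i, (convexHull ℝ (V i : Set E)).Nonempty := fun i =>
    (Finset.coe_nonempty.2 (hV i)).convexHull
  have hp : ∀ i : Fin r, ∃ p ∈ L, convexHull ℝ (V i.succ : Set E) = {p} := by
    intro i
    obtain ⟨p, hp⟩ := hV i.succ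
    exact ⟨p, hVL _ hp, eq_singleton_of_polytopeDim_eq_zero (subset_convexHull ℝ _ hp) (hpyr i)⟩
  choose p hpL hp using hp
  have hfin : ∀ k : ℕ, (((k : ℝ) • convexHull ℝ (V 0 : Set E)) ∩ (L : Set E)).Finite := fun k =>
    finite_inter_lattice_of_isBounded L
      ((isBounded_convexHull.2 (V 0).finite_toSet.isBounded).smul₀ _)
  have hstar : hStarSeries (L.prod (intLattice r))
      (cayleyPolytope fun i => convexHull ℝ (V i : Set E)) =
      hStarSeries L (convexHull ℝ (V 0 : Set E)) := by
    rw [hStarSeries, hStarSeries, polytopeDim_cayleyPolytope _ hne,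
      polytopeDim_sum_of_isPyramidFamily hne hpyr,
      ← one_sub_pow_mul_ehrhartSeries_cayleyPolytope L hV hpL hp hfin]
    ring
  rw [latticeDegree, latticeDegree, hstar]
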